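/- **Setting.** All graphs are finite and simple. An *interval model* on a vertex set $V$ assigns to each vertex a closed interval of positive length of the real line; its *interval graph* is the intersection graph of these intervals. A *box representation* of a graph $G$ on $V$ of dimension (size) $k\ge 0$ is a list $I_1,\dots,I_k$ of interval models on $V$ whose interval graphs have intersection $G$ (for $k=0$ the intersection is the complete graph), and the boxicity $\mathrm{box}(G)$ is the least dimension of a box representation of $G$. If $I$ is an interval model on a nonempty $S\subseteq V$, its *extension* to $V$ keeps the intervals of $S$ and assigns to every vertex of $V\setminus S$ the interval from the least left end point to the greatest right end point of $I$. A *circular arc (CA) model* $M$ of $G$ assigns to each vertex $v$ a closed arc $[s(v),t(v)]$ of a circle $C$, running clockwise from $s(v)$ to $t(v)\neq s(v)$, such that distinct vertices are adjacent exactly if their arcs meet. Two distinct vertices form a *circle-cover pair* if their arcs together cover $C$; $M$ is *normal* if there is no such pair. Call a point $p\in C$ *admissible* if no two of the arcs through $p$ form a circle-cover pair. **Algorithm 2** (for $M$ and an admissible point $p$). If $G$ is an interval graph, output the list consisting of one interval model of $G$. Otherwise let $A$ be the set of vertices whose arcs pass through $p$, let $p_1$ be the farthest clockwise end point and $p_2$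 the farthest anticlockwise end point of an arc through $p$, choose a point $q\ne p_1,p_2$ on the arc $[p_1,p_2]$, let $B$ be the set of vertices whose arcs pass through $q$, and let $H$ be the subgraph of $G$ induced on $A\cup B$. Take a box representation $I_1,\dots,I_h$ of $H$ of minimum dimension, an interval model $I_A$ of the subgraph induced on $V\setminus A$ and an interval model $I_B$ of the subgraph induced on $V\setminus B$. Output the extensions to $V$ of $I_1,\dots,I_h,I_A,I_B$ (the *main output* for $p,q$). **Theorem.** 1. (Correctness.) Let $M$ be a CA model of $G$ and let $p$ be admissible. Then Algorithm 2 has an output, and every output of it, whatever choices are made, is a box representation of $G$ of size at most $\mathrm{box}(G)+2$. If $G$ is not an interval graph, then a point $q$ as required exists, and for each such $q$ all the objects used in the algorithm exist. For every $q$ as required (whether or not $G$ is an interval graph), $A$ and $B$ are disjoint cliques, $H$ is a co-bipartite CA graph, and every main output for $p,q$ is a box representation of $G$ of size exactly $\mathrm{box}(H)+2\le \mathrm{box}(G)+2$. 2. If $M$ is normal, every point of the circle is admissible. 3. (Polynomial time.) There are one program and one polynomial $T$ such that, for every $n$ and every CA model $M$ of a graph $G$ on $n$ vertices that has an admissible point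 $p'$, the program, given $M$ (the positions of the $2n$ end points in their order around the circle), halts after at most $T(n)$ steps with an output of Algorithm 2 for $M$ and some admissible point $p$, which the program finds by itself. The end points of the intervals in the output are natural numbers. -/

import Mathlib

namespace BoxApprox

/-! ### Interval graphs and boxicity -/

/-- A family of nondegenerate closed intervals of the real line, one for each vertex. -/
structure IntervalModel (V : Type*) where
  left : V → ℝ
  right : V → ℝ
  left_lt_right : ∀ v, left v < right v

/-- The interval assigned to a vertex. -/
def IntervalModel.interval {V : Type*} (I : IntervalModel V) (v : V) : Set ℝ :=
  Set.Icc (I.left v) (I.right v)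

/-- The interval graph represented by an interval model. -/
def IntervalModel.graph {V : Type*} (I : IntervalModel V) : SimpleGraph V where
  Adj u v := u ≠ v ∧ (I.interval u ∩ I.interval v).Nonempty
  symm := ⟨fun _ _ h => ⟨h.1.symm, Set.inter_comm _ _ ▸ h.2⟩⟩
  loopless := ⟨fun _ h => h.1 rfl⟩

/-- `G` is an interval graph. -/
def IsIntervalGraph {V : Type*} (G : SimpleGraph V) : Prop :=
  ∃ I : IntervalModel V, I.graph = G

/-- `L` is a box representation of `G`: the graph `G` is the intersection of the interval graphs
in `L`. The dimension is `L.length`; the empty intersection is the complete graph. -/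
def IsBoxRep {V : Type*} (L : List (IntervalModel V)) (G : SimpleGraph V) : Prop :=
  ∀ u v, u ≠ v → (G.Adj u v ↔ ∀ I ∈ L, I.graph.Adj u v)

/-- The boxicity of a graph: the least dimension of a box representation. (Every finite graph has
one, so that the infimum is attained for all the graphs considered here.) -/
noncomputable def boxicity {V : Type*} (G : SimpleGraph V) : ℕ :=
  sInf {k | ∃ L : List (IntervalModel V), L.length = k ∧ IsBoxRep L G}

/-- A box representation of the least possible dimension. -/
def IsOptimalBoxRep {V : Type*} (L : List (IntervalModel V)) (G : SimpleGraph V) : Prop :=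
  IsBoxRep L G ∧ ∀ L' : List (IntervalModel V), IsBoxRep L' G → L.length ≤ L'.length

/-- `I'` is the extension to `V` of the interval model `I` on `S ⊆ V`: vertices of `S` keep their
intervals, and the others get the interval from the least left end point to the greatest right
end point of `I`. -/
def IsExtension {V : Type*} {S : Set V} (I : IntervalModel S) (I' : IntervalModel V) : Prop :=
  ∃ l r : ℝ, IsLeast (Set.range I.left) l ∧ IsGreatest (Set.range I.right) r ∧
    (∀ v : S, I'.left v = I.left v ∧ I'.right v = I.right v) ∧
    (∀ v : V, v ∉ S → I'.left v = l ∧ I'.right v = r)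

/-! ### Circular arc models -/

/-- The circle, of circumference one; the positive direction plays the role of clockwise. -/
abbrev Circ : Type := AddCircle (1 : ℝ)

/-- The coordinate in `[0, 1)` of a point of the circle. -/
noncomputable def coord (x : Circ) : ℝ := (AddCircle.equivIco (1 : ℝ) 0 x : ℝ)

/-- The clockwise distance from `x` to `y`, a number in `[0, 1)`. -/
noncomputable def cwDist (x y : Circ) : ℝ := coord (y - x)

/-- A circular arc model: each vertex `v` gets the closed arc running clockwise from `s v` to
`t v`. As `s v ≠ t v`, no arc is a single point and no arc is the whole circle. -/
structure CAModel (V : Type*) where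
  s : V → Circ
  t : V → Circ
  s_ne_t : ∀ v, s v ≠ t v

namespace CAModel

variable {V : Type*} (M : CAModel V)

/-- The closed arc `[s v, t v]`. -/
def arc (v : V) : Set Circ := Set.cIcc (M.s v) (M.t v)

/-- The circular arc graph represented by the model. -/
def graph : SimpleGraph V where
  Adj u v := u ≠ v ∧ (M.arc u ∩ M.arc v).Nonempty
  symm := ⟨fun _ _ h => ⟨h.1.symm, Set.inter_comm _ _ ▸ h.2⟩⟩
  loopless := ⟨fun _ h => h.1 rfl⟩

/-- The arcs of `u` and `v` form a circle cover pair. -/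
def IsCoverPair (u v : V) : Prop := u ≠ v ∧ M.arc u ∪ M.arc v = Set.univ

/-- A normal model has no circle cover pair. -/
def IsNormal : Prop := ∀ u v, ¬ M.IsCoverPair u v

/-- The vertices whose arcs pass through `p`. -/
def through (p : Circ) : Set V := {v | p ∈ M.arc v}

/-- No two of the arcs through `p` form a circle cover pair. -/
def NoCoverPairAt (p : Circ) : Prop :=
  ∀ u ∈ M.through p, ∀ v ∈ M.through p, ¬ M.IsCoverPair u v

/-- `q` may be chosen as the second point: `q` lies on the arc `[p₁, p₂]` and differs from `p₁`
and `p₂`, where `p₁ = t a` is the farthest clockwise end point and `p₂ = s b` the farthest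
anticlockwise end point of an arc through `p`. -/
def IsSecondPoint (p q : Circ) : Prop :=
  ∃ a ∈ M.through p, ∃ b ∈ M.through p,
    (∀ c ∈ M.through p, cwDist p (M.t c) ≤ cwDist p (M.t a)) ∧
    (∀ c ∈ M.through p, cwDist (M.s c) p ≤ cwDist (M.s b) p) ∧
    q ∈ Set.cIcc (M.t a) (M.s b) ∧ q ≠ M.t a ∧ q ≠ M.s b

/-- The subgraph `H` induced on the vertices whose arcs pass through `p` or through `q`. -/
def subgraphAt (p q : Circ) : SimpleGraph ↥(M.through p ∪ M.through q) :=
  M.graph.induce (M.through p ∪ M.through q)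

/-- `out` may be returned by the main part of the algorithm, when it has chosen `p` and `q`, for
some outcome of the remaining choices. With `A` and `B` the cliques at `p` and `q`: take an
optimum box representation of `H`, an interval model of the subgraph induced on `V \ A` and one
of the subgraph induced on `V \ B`, and return the extensions to `V` of all of these. -/
def IsMainOutput (p q : Circ) (out : List (IntervalModel V)) : Prop :=
  ∃ (L : List (IntervalModel ↥(M.through p ∪ M.through q))) (L' : List (IntervalModel V))
    (IA : IntervalModel ↥(M.through p)ᶜ) (IA' : IntervalModel V)
    (IB : IntervalModel ↥(M.through q)ᶜ) (IB' : IntervalModel V),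
    IsOptimalBoxRep L (M.subgraphAt p q) ∧ List.Forall₂ IsExtension L L' ∧
    IA.graph = M.graph.induce (M.through p)ᶜ ∧ IsExtension IA IA' ∧
    IB.graph = M.graph.induce (M.through q)ᶜ ∧ IsExtension IB IB' ∧
    out = L' ++ [IA', IB']

/-- `out` may be returned by the whole algorithm, run with the point `p`: if the graph is an
interval graph, return an interval model of it; otherwise choose a second point `q` and return an
output of the main part. -/
def IsAlgorithmOutput (p : Circ) (out : List (IntervalModel V)) : Prop :=
  (IsIntervalGraph M.graph ∧ ∃ I : IntervalModel V, I.graph = M.graph ∧ out = [I]) ∨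
  (¬ IsIntervalGraph M.graph ∧ ∃ q, M.IsSecondPoint p q ∧ M.IsMainOutput p q out)

end CAModel

/-- `G` is a circular arc graph. -/
def IsCAGraph {V : Type*} (G : SimpleGraph V) : Prop :=
  ∃ M : CAModel V, M.graph = G

/-! ### The machine model: a while language on binary trees -/

/-- The values of the machine: binary trees of cells. -/
inductive Data : Type
  | nil : Data
  | cons : Data → Data → Data

/-- First component of a cell. -/
def Data.head : Data → Data
  | .nil => .nil
  | .cons a _ => a

/-- Second component of a cell. -/
def Data.tail : Data → Data
  | .nil => .nil
  | .cons _ b => b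

/-- Programs; each acts on one value, its current state. `nil` counts as false and every cell as
true. -/
inductive Prog : Type
  | skip : Prog
  | nil : Prog
  | head : Prog
  | tail : Prog
  | cons : Prog → Prog → Prog
  | seq : Prog → Prog → Prog
  | ite : Prog → Prog → Prog → Prog
  | loop : Prog → Prog → Prog

/-- `Runs P x y k`: the program `P`, started on `x`, halts with the value `y` after exactly `k`
steps. A step allocates at most one cell, follows one pointer or tests one value for `nil`; values
are shared and never copied, and there is no arithmetic and no comparison of whole trees. -/
inductive Runs : Prog → Data → Data → ℕ → Prop
  | skip (x : Data) : Runs .skip x x 1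
  | nil (x : Data) : Runs .nil x .nil 1
  | head (x : Data) : Runs .head x x.head 1
  | tail (x : Data) : Runs .tail x x.tail 1
  | cons {f g : Prog} {x a b : Data} {i j : ℕ} :
      Runs f x a i → Runs g x b j → Runs (.cons f g) x (.cons a b) (i + j + 1)
  | seq {f g : Prog} {x y z : Data} {i j : ℕ} :
      Runs f x y i → Runs g y z j → Runs (.seq f g) x z (i + j + 1)
  | ite_true {c f g : Prog} {x a b y : Data} {i j : ℕ} :
      Runs c x (.cons a b) i → Runs f x y j → Runs (.ite c f g) x y (i + j + 1)
  | ite_false {c f g : Prog} {x y : Data} {i j : ℕ} :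
      Runs c x .nil i → Runs g x y j → Runs (.ite c f g) x y (i + j + 1)
  | loop_stop {c f : Prog} {x : Data} {i : ℕ} :
      Runs c x .nil i → Runs (.loop c f) x x (i + 1)
  | loop_step {c f : Prog} {x a b y z : Data} {i j k : ℕ} :
      Runs c x (.cons a b) i → Runs f x y j → Runs (.loop c f) y z k →
      Runs (.loop c f) x z (i + j + k + 1)

/-- The machine is deterministic. -/
theorem Runs.det {P : Prog} {x y : Data} {k : ℕ} (h : Runs P x y k) :
    ∀ {y' : Data} {k' : ℕ}, Runs P x y' k' → y = y' ∧ k = k' := by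
  induction h with
  | skip x => intro _ _ h; cases h; exact ⟨rfl, rfl⟩
  | nil x => intro _ _ h; cases h; exact ⟨rfl, rfl⟩
  | head x => intro _ _ h; cases h; exact ⟨rfl, rfl⟩
  | tail x => intro _ _ h; cases h; exact ⟨rfl, rfl⟩
  | cons _ _ ih₁ ih₂ =>
    intro _ _ h
    cases h with
    | cons h₁ h₂ =>
      obtain ⟨rfl, rfl⟩ := ih₁ h₁
      obtain ⟨rfl, rfl⟩ := ih₂ h₂
      exact ⟨rfl, rfl⟩
  | seq _ _ ih₁ ih₂ =>
    intro _ _ h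
    cases h with
    | seq h₁ h₂ =>
      obtain ⟨rfl, rfl⟩ := ih₁ h₁
      obtain ⟨rfl, rfl⟩ := ih₂ h₂
      exact ⟨rfl, rfl⟩
  | ite_true _ _ ih₁ ih₂ =>
    intro _ _ h
    cases h with
    | ite_true h₁ h₂ =>
      obtain ⟨_, rfl⟩ := ih₁ h₁
      obtain ⟨rfl, rfl⟩ := ih₂ h₂
      exact ⟨rfl, rfl⟩
    | ite_false h₁ h₂ => exact absurd (ih₁ h₁).1 (by simp)
  | ite_false _ _ ih₁ ih₂ =>
    intro _ _ h
    cases h with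
    | ite_true h₁ h₂ => exact absurd (ih₁ h₁).1 (by simp)
    | ite_false h₁ h₂ =>
      obtain ⟨_, rfl⟩ := ih₁ h₁
      obtain ⟨rfl, rfl⟩ := ih₂ h₂
      exact ⟨rfl, rfl⟩
  | loop_stop _ ih₁ =>
    intro _ _ h
    cases h with
    | loop_stop h₁ => obtain ⟨_, rfl⟩ := ih₁ h₁; exact ⟨rfl, rfl⟩
    | loop_step h₁ _ _ => exact absurd (ih₁ h₁).1 (by simp)
  | loop_step _ _ _ ih₁ ih₂ ih₃ =>
    intro _ _ h
    cases h with
    | loop_stop h₁ => exact absurd (ih₁ h₁).1 (by simp)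
    | loop_step h₁ h₂ h₃ =>
      obtain ⟨_, rfl⟩ := ih₁ h₁
      obtain ⟨rfl, rfl⟩ := ih₂ h₂
      obtain ⟨rfl, rfl⟩ := ih₃ h₃
      exact ⟨rfl, rfl⟩

/-! ### Encoding of inputs and outputs -/

/-- Unary numerals. -/
def Data.ofNat : ℕ → Data
  | 0 => .nil
  | k + 1 => .cons .nil (Data.ofNat k)

/-- Linked lists. -/
def Data.ofList : List Data → Data
  | [] => .nil
  | a :: l => .cons a (Data.ofList l)

/-- The position of a point in the order of the end points of the model along the circle, from
coordinate `0` on: the number of points that are end points of arcs and have a smaller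
coordinate. -/
noncomputable def CAModel.rank {V : Type*} (M : CAModel V) (x : Circ) : ℕ :=
  Set.ncard {y | (∃ v, y = M.s v ∨ y = M.t v) ∧ coord y < coord x}

/-- A circular arc model as an input: the list of the pairs of positions of the start point and
the end point of the arcs. All positions are less than `2 * n`. -/
noncomputable def CAModel.code {n : ℕ} (M : CAModel (Fin n)) : Data :=
  Data.ofList (List.ofFn fun v =>
    Data.cons (Data.ofNat (M.rank (M.s v))) (Data.ofNat (M.rank (M.t v))))

/-- `d` encodes the interval model `I`, as the list of the pairs of end points, which have to be
natural numbers. -/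
def IntervalModel.HasCode {n : ℕ} (I : IntervalModel (Fin n)) (d : Data) : Prop :=
  ∃ l r : Fin n → ℕ, (∀ v, I.left v = l v ∧ I.right v = r v) ∧
    d = Data.ofList (List.ofFn fun v => Data.cons (Data.ofNat (l v)) (Data.ofNat (r v)))

/-- `d` encodes the list `L` of interval models. -/
def HasCode {n : ℕ} (L : List (IntervalModel (Fin n))) (d : Data) : Prop :=
  ∃ ds : List Data, List.Forall₂ IntervalModel.HasCode L ds ∧ d = Data.ofList ds

end BoxApprox

/-! Correctness. Cutting the circle at a point turns the arcs that avoid it into intervals, so `G -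
A` and `G - B` are interval graphs, while `A` and `B` are cliques. An arc through `p` misses an open
interval. Admissibility of `p` means that every end of an arc through `p`, read clockwise from `p`,
comes before every start, so the missed intervals have a common part. The second points are exactly
the points of this part (`isSecondPoint_iff`), whence `A` and `B` are disjoint. An extension only
adds universal vertices. Any two vertices lie together in `A ∪ B`, in `V \ A` or in `V \ B`, so
every nonedge is recorded by some model (`IsMainOutput.isBoxRep`). The size bound is monotonicity of
boxicity under induced subgraphs.

Polynomial time needs exact solutions of two problems.

Recognising interval graphs. If `uv` and `u'v'` are nonedges, with `u` equal or adjacent to `u'` and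
`v` to `v'`, then every interval model orders the two pairs alike. If a class of this forcing
relation contains a pair and its reversal, no model exists. Otherwise each class is oriented by
comparing its least pair index with that of the reversed class. A triangle lemma, as for transitive
orientations, shows that no directed triangle arises (`lexRel_acyclic`), and the result is an
interval order.

Optimum box representations of `H`. Nonadjacent pairs from `A × B` carry a partial order `below`. If
one pair is below another, the four vertices induce a 4-cycle, so one interval model cannot separate
both pairs; hence a chain needs as many models as it has elements. Conversely, peeling off minimal
pairs as in Mirsky's theorem gives as many layers as a longest chain has elements, and the minimal
pairs of each layer are separated by one interval order (`isIntervalOrder_layerRel`). So the layers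
are optimal (`IsGapPair.isOptimalBoxRep`).

All models that are output come from interval orders by counting predecessors. Vertices incomparable
to all others get `[1, 2n]`, which is precisely the interval an extension requires. Running times
follow from closure of `PT` under composition and folds with bounded states. Testing the gaps
between end points suffices, because an admissible point can be moved into a gap without meeting new
arcs (`exists_through_subset`). -/

namespace BoxApprox

/-! ### Polynomial time functions -/

/-- The number of nodes of a tree. -/
def Data.size : Data → ℕ
  | .nil => 1
  | .cons a b => a.size + b.size + 1

/-- Types whose elements are represented by trees. -/
class Enc (α : Type*) where
  enc : α → Data

open Enc

instance : Enc ℕ := ⟨Data.ofNat⟩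
instance : Enc Unit := ⟨fun _ => .nil⟩
instance : Enc Bool := ⟨fun b => bif b then .cons .nil .nil else .nil⟩
instance {α β : Type*} [Enc α] [Enc β] : Enc (α × β) := ⟨fun x => .cons (enc x.1) (enc x.2)⟩
instance {α : Type*} [Enc α] : Enc (List α) := ⟨fun l => Data.ofList (l.map enc)⟩

/-- The size of the encoding of a value. -/
def esize {α : Type*} [Enc α] (a : α) : ℕ := (enc a).size

/-- The pairs with components in two lists. -/
def pairs {β γ : Type*} (l : List β) (l' : List γ) : List (β × γ) :=
  (l.map fun b => l'.map fun c => (b, c)).flatten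

theorem mem_pairs {β γ : Type*} {l : List β} {l' : List γ} {b : β} {c : γ} :
    (b, c) ∈ pairs l l' ↔ b ∈ l ∧ c ∈ l' := by
  simp [pairs]

section
variable {α β γ σ : Type*} [Enc α] [Enc β] [Enc γ] [Enc σ]

theorem enc_list_cons (a : α) (l : List α) : enc (a :: l) = .cons (enc a) (enc l) := rfl
theorem enc_succ (n : ℕ) : enc (n + 1) = .cons .nil (enc n) := rfl

@[simp] theorem esize_pair (a : α) (b : β) : esize (a, b) = esize a + esize b + 1 := rfl
@[simp] theorem esize_list_nil : esize ([] : List α) = 1 := rfl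
@[simp] theorem esize_list_cons (a : α) (l : List α) :
    esize (a :: l) = esize a + esize l + 1 := rfl

@[simp] theorem esize_nat (n : ℕ) : esize n = 2 * n + 1 := by
  induction n with
  | zero => rfl
  | succ n ih =>
    have h : esize (n + 1) = 1 + esize n + 1 := rfl
    omega

theorem esize_bool_le (b : Bool) : esize b ≤ 3 := by cases b <;> decide

theorem length_lt_esize (l : List α) : l.length < esize l := by
  induction l with
  | nil => simp
  | cons a l ih => simp only [List.length_cons, esize_list_cons]; omega

theorem esize_le_of_mem {a : α} {l : List α} (h : a ∈ l) : esize a ≤ esize l := by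
  induction l with
  | nil => simp at h
  | cons b l ih =>
    rcases List.mem_cons.1 h with rfl | h
    · simp only [esize_list_cons]; omega
    · have := ih h; simp only [esize_list_cons]; omega

theorem esize_append (l l' : List α) : esize (l ++ l') + 1 = esize l + esize l' := by
  induction l with
  | nil => simp; omega
  | cons b l ih => simp only [List.cons_append, esize_list_cons]; omega

theorem esize_filter_le (p : α → Bool) (l : List α) : esize (l.filter p) ≤ esize l := by
  induction l with
  | nil => simp
  | cons b l ih => rw [List.filter_cons]; split <;> simp only [esize_list_cons] <;> omega

/-- Natural coefficients make polynomials monotone, so that bounds can be substituted into one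
another. -/
theorem eval_mono (T : Polynomial ℕ) {a b : ℕ} (h : a ≤ b) : T.eval a ≤ T.eval b := by
  rw [Polynomial.eval_eq_sum, Polynomial.eval_eq_sum]
  exact Finset.sum_le_sum fun i _ => Nat.mul_le_mul_left _ (Nat.pow_le_pow_left h i)

/-- Functions computed by a program in polynomial time, with values of polynomial size. -/
@[fun_prop]
def PT (f : α → β) : Prop :=
  ∃ (P : Prog) (T : Polynomial ℕ), ∀ a, ∃ k, Runs P (enc a) (enc (f a)) k ∧
    k + esize (f a) ≤ T.eval (esize a)

@[fun_prop]
theorem PT.id : PT (fun x : α => x) :=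
  ⟨.skip, 1 + Polynomial.X, fun a => ⟨1, .skip _, by simp⟩⟩

/-- A program that builds a fixed tree. -/
def constProg : Data → Prog
  | .nil => .nil
  | .cons a b => .cons (constProg a) (constProg b)

theorem constProg_runs (d : Data) : ∃ k, ∀ x, Runs (constProg d) x d k := by
  induction d with
  | nil => exact ⟨1, .nil⟩
  | cons a b iha ihb =>
    obtain ⟨i, hi⟩ := iha
    obtain ⟨j, hj⟩ := ihb
    exact ⟨i + j + 1, fun x => .cons (hi x) (hj x)⟩

@[fun_prop]
theorem PT.const (b : β) : PT (fun _ : α => b) := by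
  obtain ⟨k, hk⟩ := constProg_runs (enc b)
  exact ⟨constProg (enc b), Polynomial.C (k + esize b), fun a => ⟨k, hk _, by simp⟩⟩

-- Time bounds alone do not compose: as cells are shared, a short run can build a tree with
-- exponentially many nodes. The size bound inside `PT` controls the input of the outer program.
@[fun_prop]
theorem PT.comp {g : β → γ} {f : α → β} (hg : PT g) (hf : PT f) : PT (fun x => g (f x)) := by
  obtain ⟨P, T, hP⟩ := hf
  obtain ⟨Q, S, hQ⟩ := hg
  refine ⟨.seq P Q, T + S.comp T + 1, fun a => ?_⟩
  obtain ⟨i, hi, hi'⟩ := hP a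
  obtain ⟨j, hj, hj'⟩ := hQ (f a)
  refine ⟨i + j + 1, .seq hi hj, ?_⟩
  have := eval_mono S (show esize (f a) ≤ T.eval (esize a) by omega)
  simp only [Polynomial.eval_add, Polynomial.eval_comp, Polynomial.eval_one]
  omega

@[fun_prop]
theorem PT.pair {f : α → β} {g : α → γ} (hf : PT f) (hg : PT g) : PT (fun x => (f x, g x)) := by
  obtain ⟨P, T, hP⟩ := hf
  obtain ⟨Q, S, hQ⟩ := hg
  refine ⟨.cons P Q, T + S + 2, fun a => ?_⟩
  obtain ⟨i, hi, hi'⟩ := hP a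
  obtain ⟨j, hj, hj'⟩ := hQ a
  refine ⟨i + j + 1, .cons hi hj, ?_⟩
  simp
  omega

@[fun_prop]
theorem PT.fst {f : α → β × γ} (hf : PT f) : PT (fun x => (f x).1) := by
  refine PT.comp (g := fun x : β × γ => x.1) ⟨.head, 1 + Polynomial.X, fun a => ⟨1, .head _, ?_⟩⟩ hf
  obtain ⟨b, c⟩ := a
  simp; omega

@[fun_prop]
theorem PT.snd {f : α → β × γ} (hf : PT f) : PT (fun x => (f x).2) := by
  refine PT.comp (g := fun x : β × γ => x.2) ⟨.tail, 1 + Polynomial.X, fun a => ⟨1, .tail _, ?_⟩⟩ hf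
  obtain ⟨b, c⟩ := a
  simp; omega

/-- A function whose values have the encodings of the values of `f`, up to a program. -/
theorem PT.of_enc {f : α → β} {g : α → γ} (hf : PT f) (h : ∀ a, enc (g a) = enc (f a)) :
    PT g := by
  obtain ⟨P, T, hP⟩ := hf
  refine ⟨P, T, fun a => ?_⟩
  have h' : esize (g a) = esize (f a) := congrArg Data.size (h a)
  rw [h, h']
  exact hP a

@[fun_prop]
theorem PT.cons {f : α → β} {g : α → List β} (hf : PT f) (hg : PT g) :
    PT (fun x => f x :: g x) :=
  PT.of_enc (PT.pair hf hg) fun _ => rfl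

@[fun_prop]
theorem PT.cond {c : α → Bool} {f g : α → β} (hc : PT c) (hf : PT f) (hg : PT g) :
    PT (fun x => bif c x then f x else g x) := by
  obtain ⟨R, U, hR⟩ := hc
  obtain ⟨P, T, hP⟩ := hf
  obtain ⟨Q, S, hQ⟩ := hg
  refine ⟨.ite R P Q, U + T + S + 1, fun a => ?_⟩
  obtain ⟨k, hk, hk'⟩ := hR a
  obtain ⟨i, hi, hi'⟩ := hP a
  obtain ⟨j, hj, hj'⟩ := hQ a
  simp only [Polynomial.eval_add, Polynomial.eval_one]
  cases h : c a
  · rw [h] at hk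
    exact ⟨k + j + 1, .ite_false hk hj, by simp only [cond_false]; omega⟩
  · rw [h] at hk
    exact ⟨k + i + 1, .ite_true hk hi, by simp only [cond_true]; omega⟩

@[fun_prop]
theorem PT.nonempty {l : α → List β} (hl : PT l) : PT (fun x => !(l x).isEmpty) := by
  refine PT.comp (g := fun l : List β => !l.isEmpty)
    ⟨.ite .skip (constProg (enc true)) (constProg (enc false)), 8, fun a => ?_⟩ hl
  have h3 := esize_bool_le (!a.isEmpty)
  cases a with
  | nil =>
    exact ⟨3, .ite_false (.skip _) (.nil _), by simp at h3 ⊢; omega⟩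
  | cons b l =>
    exact ⟨5, .ite_true (.skip _) (.cons (.nil _) (.nil _)), by simp at h3 ⊢; omega⟩

@[fun_prop]
theorem PT.tail {l : α → List β} (hl : PT l) : PT (fun x => (l x).tail) := by
  refine PT.comp (g := fun l : List β => l.tail) ⟨.tail, 1 + Polynomial.X, fun a => ⟨1, ?_, ?_⟩⟩ hl
  · cases a
    · exact .tail _
    · exact .tail _
  · cases a with
    | nil => simp
    | cons b l => simp; omega

@[fun_prop]
theorem PT.headD {l : α → List β} {d : α → β} (hl : PT l) (hd : PT d) :
    PT (fun x => (l x).headD (d x)) := by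
  refine PT.comp (g := fun x : List β × β => x.1.headD x.2)
    ⟨.ite .head (.seq .head .head) .tail, Polynomial.X + 6, fun a => ?_⟩ (hl.pair hd)
  obtain ⟨l, d⟩ := a
  cases l with
  | nil => exact ⟨3, .ite_false (.head _) (.tail _), by simp; omega⟩
  | cons b l =>
    exact ⟨5, .ite_true (.head _) (.seq (.head _) (.head _)), by simp; omega⟩

/-- The `3` is the cost of the guard `.seq .tail .head`. A round costs the guard, the body and one
step, hence at most `B + 4`; the failing test at the end costs `4`. -/
theorem loop_runs {c f : Prog} {g : ℕ → Data} {m B : ℕ} {z : Data}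
    (hc : ∀ i < m, ∃ a b, Runs c (g i) (.cons a b) 3) (hm : Runs c (g m) .nil 3)
    (hf : ∀ i < m, ∃ k ≤ B, Runs f (g i) (g (i + 1)) k) (hz : g m = z) :
    ∃ k ≤ m * (B + 4) + 4, Runs (.loop c f) (g 0) z k := by
  subst hz
  suffices h : ∀ i ≤ m, ∃ k ≤ i * (B + 4) + 4, Runs (.loop c f) (g (m - i)) (g m) k by
    simpa using h m le_rfl
  intro i
  induction i with
  | zero => intro _; exact ⟨4, by simp, Runs.loop_stop hm⟩
  | succ i ih =>
    intro hi
    obtain ⟨k, hk, hk'⟩ := ih (by omega)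
    obtain ⟨a, b, hab⟩ := hc (m - (i + 1)) (by omega)
    obtain ⟨j, hj, hj'⟩ := hf (m - (i + 1)) (by omega)
    rw [show m - (i + 1) + 1 = m - i by omega] at hj'
    exact ⟨3 + j + k + 1, by rw [Nat.succ_mul]; omega, .loop_step hab hj' hk'⟩

/-- Folds are computed in polynomial time if the states are polynomially bounded. -/
theorem PT.foldl_of_bound {step : α → σ → β → σ} {l : α → List β} {init : α → σ}
    (hs : PT (fun z : α × σ × β => step z.1 z.2.1 z.2.2)) (hl : PT l) (hi : PT init)
    (hV : ∃ V : Polynomial ℕ, ∀ x, ∀ i ≤ (l x).length,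
      esize (((l x).take i).foldl (step x) (init x)) ≤ V.eval (esize x)) :
    PT (fun x => (l x).foldl (step x) (init x)) := by
  obtain ⟨P, T, hP⟩ := hs
  obtain ⟨Q, S, hQ⟩ := hl
  obtain ⟨R, U, hR⟩ := hi
  obtain ⟨V, hsizeV⟩ := hV
  -- The step acts on `x`, a state of size at most `V` and an element of a list of size at most `S`;
  -- the `2` counts the pair nodes.
  let W := T.comp (Polynomial.X + V + S + 2)
  -- The machine holds `x`, the unread rest of the list and the accumulator. The loop stops when the
  -- rest is `nil`, and the last program extracts the accumulator.
  refine ⟨.seq (.cons .skip (.cons Q R)) (.seq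
    (.loop (.seq .tail .head)
      (.cons .head (.cons (.seq .tail (.seq .head .tail))
        (.seq (.cons .head (.cons (.seq .tail .tail) (.seq .tail (.seq .head .head)))) P))))
    (.seq .tail .tail)), S + U + S * (W + 40) + V + 40, fun x => ?_⟩
  obtain ⟨kq, hq, hq'⟩ := hQ x
  obtain ⟨kr, hr, hr'⟩ := hR x
  let st : ℕ → σ := fun i => ((l x).take i).foldl (step x) (init x)
  let g : ℕ → Data := fun i => .cons (enc x) (.cons (enc ((l x).drop i)) (enc (st i)))
  have hst : ∀ i (h : i < (l x).length), st (i + 1) = step x (st i) (l x)[i] := by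
    intro i h
    simp only [st]
    rw [List.take_succ_eq_append_getElem h, List.foldl_append]
    rfl
  have hdrop : ∀ i (h : i < (l x).length), enc ((l x).drop i) =
      .cons (enc (l x)[i]) (enc ((l x).drop (i + 1))) := by
    intro i h
    rw [List.drop_eq_getElem_cons h]; rfl
  have hlen := length_lt_esize (l x)
  replace hsizeV : ∀ i ≤ (l x).length, esize (st i) ≤ V.eval (esize x) := hsizeV x
  have hloop := loop_runs (c := .seq .tail .head)
    (f := .cons .head (.cons (.seq .tail (.seq .head .tail))
        (.seq (.cons .head (.cons (.seq .tail .tail) (.seq .tail (.seq .head .head)))) P)))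
    (g := g) (m := (l x).length) (B := W.eval (esize x) + 30)
    (z := .cons (enc x) (.cons .nil (enc ((l x).foldl (step x) (init x)))))
    (fun i h => ⟨enc (l x)[i], enc ((l x).drop (i + 1)), by
      have : g i = .cons (enc x) (.cons (.cons (enc (l x)[i]) (enc ((l x).drop (i + 1))))
        (enc (st i))) := by simp only [g]; rw [hdrop i h]
      rw [this]
      exact .seq (.tail _) (.head _)⟩)
    (by
      have : g (l x).length = .cons (enc x) (.cons .nil (enc (st (l x).length))) := by
        simp only [g, List.drop_length]; rfl
      rw [this]
      exact .seq (.tail _) (.head _))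
    (fun i h => by
      obtain ⟨k, hk, hk'⟩ := hP (x, st i, (l x)[i])
      have h1 : g i = .cons (enc x) (.cons (.cons (enc (l x)[i]) (enc ((l x).drop (i + 1))))
        (enc (st i))) := by simp only [g]; rw [hdrop i h]
      have h2 : g (i + 1) = .cons (enc x) (.cons (enc ((l x).drop (i + 1)))
        (enc (step x (st i) (l x)[i]))) := by simp only [g]; rw [hst i h]
      rw [h1, h2]
      refine ⟨_, ?_, .cons (.head _) (.cons (.seq (.tail _) (.seq (.head _) (.tail _)))
        (.seq (.cons (.head _) (.cons (.seq (.tail _) (.tail _))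
          (.seq (.tail _) (.seq (.head _) (.head _))))) hk))⟩
      have h3 := hsizeV i (by omega)
      have h4 := esize_le_of_mem (List.getElem_mem h)
      have h5 : k ≤ W.eval (esize x) := by
        have h6 : esize (x, st i, (l x)[i]) ≤
            (Polynomial.X + V + S + 2 : Polynomial ℕ).eval (esize x) := by
          simp
          omega
        have h7 := eval_mono T h6
        simp only [W, Polynomial.eval_comp]
        omega
      omega)
    (by
      simp only [g, st, List.drop_length, List.take_length]; rfl)
  obtain ⟨k, hk, hk'⟩ := hloop
  have h0 : g 0 = .cons (enc x) (.cons (enc (l x)) (enc (init x))) := by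
    simp [g, st]
  rw [h0] at hk'
  refine ⟨_, .seq (.cons (.skip _) (.cons hq hr)) (.seq hk' (.seq (.tail _) (.tail _))), ?_⟩
  have h1 := hsizeV _ le_rfl
  have h2 : esize (List.foldl (step x) (init x) (l x)) ≤ V.eval (esize x) := by
    simpa [st] using h1
  have h3 : (l x).length * (W.eval (esize x) + 30 + 4) ≤
      S.eval (esize x) * (W.eval (esize x) + 40) :=
    Nat.mul_le_mul (by omega) (by omega)
  simp only [Polynomial.eval_add, Polynomial.eval_mul, Polynomial.eval_ofNat]
  omega

/-- Folds are computed in polynomial time if every step enlarges the state by a polynomially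
bounded amount only. -/
theorem PT.foldl {step : α → σ → β → σ} {l : α → List β} {init : α → σ}
    (hs : PT (fun z : α × σ × β => step z.1 z.2.1 z.2.2)) (hl : PT l) (hi : PT init)
    (hB : ∃ B : Polynomial ℕ, ∀ x s, ∀ a ∈ l x, esize (step x s a) ≤ esize s + B.eval (esize x)) :
    PT (fun x => (l x).foldl (step x) (init x)) := by
  refine PT.foldl_of_bound hs hl hi ?_
  obtain ⟨Q, S, hQ⟩ := hl
  obtain ⟨R, U, hR⟩ := hi
  obtain ⟨B, hB⟩ := hB
  refine ⟨U + S * B, fun x => ?_⟩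
  obtain ⟨kq, hq, hq'⟩ := hQ x
  obtain ⟨kr, hr, hr'⟩ := hR x
  have hsize : ∀ i ≤ (l x).length, esize (((l x).take i).foldl (step x) (init x)) ≤
      esize (init x) + i * B.eval (esize x) := by
    intro i
    induction i with
    | zero => intro _; simp
    | succ i ih =>
      intro h
      rw [List.take_succ_eq_append_getElem h, List.foldl_append]
      have := hB x (((l x).take i).foldl (step x) (init x)) (l x)[i] (List.getElem_mem _)
      have := ih (by omega)
      rw [Nat.succ_mul, List.foldl_cons, List.foldl_nil]
      omega
  intro i h
  have h1 := hsize i h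
  have hlen := length_lt_esize (l x)
  have h2 : i * B.eval (esize x) ≤ S.eval (esize x) * B.eval (esize x) :=
    Nat.mul_le_mul_right _ (by omega)
  simp only [Polynomial.eval_add, Polynomial.eval_mul]
  omega

theorem PT.exists_esize_le {f : α → β} (hf : PT f) :
    ∃ T : Polynomial ℕ, ∀ x, esize (f x) ≤ T.eval (esize x) := by
  obtain ⟨P, T, hP⟩ := hf
  refine ⟨T, fun x => ?_⟩
  obtain ⟨k, -, hk⟩ := hP x
  omega

/-! ### Booleans -/

@[fun_prop]
theorem PT.not {f : α → Bool} (hf : PT f) : PT (fun x => !f x) := by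
  have h : (fun x => !f x) = fun x => bif f x then false else true := by
    funext x; cases f x <;> rfl
  rw [h]; fun_prop

@[fun_prop]
theorem PT.and {f g : α → Bool} (hf : PT f) (hg : PT g) : PT (fun x => f x && g x) := by
  have h : (fun x => f x && g x) = fun x => bif f x then g x else false := by
    funext x; cases f x <;> rfl
  rw [h]; fun_prop

@[fun_prop]
theorem PT.or {f g : α → Bool} (hf : PT f) (hg : PT g) : PT (fun x => f x || g x) := by
  have h : (fun x => f x || g x) = fun x => bif f x then true else g x := by
    funext x; cases f x <;> rfl
  rw [h]; fun_prop

/-! ### Lists -/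

@[fun_prop]
theorem PT.reverse {l : α → List β} (hl : PT l) : PT (fun x => (l x).reverse) := by
  have h : (fun x => (l x).reverse) = fun x => (l x).foldl (fun acc a => a :: acc) [] := by
    funext x; simp
  rw [h]
  refine PT.foldl (step := fun _ acc a => a :: acc) (by fun_prop) hl (by fun_prop) ?_
  obtain ⟨T, hT⟩ := hl.exists_esize_le
  refine ⟨T + 1, fun x s a ha => ?_⟩
  have h1 := esize_le_of_mem ha
  have h2 := hT x
  simp only [esize_list_cons, Polynomial.eval_add, Polynomial.eval_one]
  omega

@[fun_prop]
theorem PT.map {f : α → β → γ} {l : α → List β} (hf : PT (fun z : α × β => f z.1 z.2))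
    (hl : PT l) : PT (fun x => (l x).map (f x)) := by
  have h : (fun x => (l x).map (f x)) =
      fun x => ((l x).foldl (fun acc a => f x a :: acc) []).reverse := by
    funext x
    suffices h : ∀ (l : List β) (acc : List γ), l.foldl (fun acc a => f x a :: acc) acc =
        (l.map (f x)).reverse ++ acc by simp [h]
    intro l
    induction l with
    | nil => simp
    | cons b l ih => intro acc; simp [ih]
  rw [h]
  refine PT.reverse (PT.foldl (step := fun x acc a => f x a :: acc) ?_ hl (by fun_prop) ?_)
  · exact PT.cons (hf.comp (f := fun z : α × List γ × β => (z.1, z.2.2)) (by fun_prop)) (by fun_prop)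
  obtain ⟨T, hT⟩ := hl.exists_esize_le
  obtain ⟨S, hS⟩ := hf.exists_esize_le
  refine ⟨S.comp (Polynomial.X + T + 1) + 1, fun x s a ha => ?_⟩
  have h1 := esize_le_of_mem ha
  have h2 := hT x
  have h3 := hS (x, a)
  have h4 := eval_mono S (show esize (x, a) ≤
    (Polynomial.X + T + 1 : Polynomial ℕ).eval (esize x) by simp; omega)
  simp only [esize_list_cons, Polynomial.eval_add, Polynomial.eval_one, Polynomial.eval_comp] at *
  omega

@[fun_prop]
theorem PT.filter {p : α → β → Bool} {l : α → List β} (hp : PT (fun z : α × β => p z.1 z.2))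
    (hl : PT l) : PT (fun x => (l x).filter (p x)) := by
  have h : (fun x => (l x).filter (p x)) =
      fun x => ((l x).foldl (fun acc a => bif p x a then a :: acc else acc) []).reverse := by
    funext x
    suffices h : ∀ (l acc : List β), l.foldl (fun acc a => bif p x a then a :: acc else acc) acc =
        (l.filter (p x)).reverse ++ acc by simp [h]
    intro l
    induction l with
    | nil => simp
    | cons b l ih => intro acc; cases hb : p x b <;> simp [ih, hb]
  rw [h]
  refine PT.reverse (PT.foldl (step := fun x acc a => bif p x a then a :: acc else acc) ?_ hl
    (by fun_prop) ?_)
  · exact PT.cond (hp.comp (f := fun z : α × List β × β => (z.1, z.2.2)) (by fun_prop))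
      (by fun_prop) (by fun_prop)
  obtain ⟨T, hT⟩ := hl.exists_esize_le
  refine ⟨T + 1, fun x s a ha => ?_⟩
  have h1 := esize_le_of_mem ha
  have h2 := hT x
  simp only [Polynomial.eval_add, Polynomial.eval_one]
  cases p x a
  · simp
  · simp; omega

@[fun_prop]
theorem PT.any {p : α → β → Bool} {l : α → List β} (hp : PT (fun z : α × β => p z.1 z.2))
    (hl : PT l) : PT (fun x => (l x).any (p x)) := by
  have h : (fun x => (l x).any (p x)) = fun x => !((l x).filter (p x)).isEmpty := by
    funext x
    rw [Bool.eq_iff_iff]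
    simp
  rw [h]; fun_prop

@[fun_prop]
theorem PT.all {p : α → β → Bool} {l : α → List β} (hp : PT (fun z : α × β => p z.1 z.2))
    (hl : PT l) : PT (fun x => (l x).all (p x)) := by
  have h : (fun x => (l x).all (p x)) = fun x => !((l x).any fun a => !(p x a)) := by
    funext x
    rw [List.all_eq_not_any_not]
  rw [h]; fun_prop

@[fun_prop]
theorem PT.append {l l' : α → List β} (hl : PT l) (hl' : PT l') :
    PT (fun x => l x ++ l' x) := by
  have h : (fun x => l x ++ l' x) =
      fun x => (l x).reverse.foldl (fun acc a => a :: acc) (l' x) := by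
    funext x
    simp
  rw [h]
  refine PT.foldl (step := fun _ acc a => a :: acc) (by fun_prop) (by fun_prop) hl' ?_
  obtain ⟨T, hT⟩ := hl.exists_esize_le
  refine ⟨T + 1, fun x s a ha => ?_⟩
  have h1 := esize_le_of_mem (List.mem_reverse.1 ha)
  have h2 := hT x
  simp only [esize_list_cons, Polynomial.eval_add, Polynomial.eval_one]
  omega

@[fun_prop]
theorem PT.flatten {l : α → List (List β)} (hl : PT l) : PT (fun x => (l x).flatten) := by
  have h : (fun x => (l x).flatten) = fun x => (l x).foldl (fun acc a => acc ++ a) [] := by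
    funext x
    suffices h : ∀ (l : List (List β)) (acc : List β), l.foldl (fun acc a => acc ++ a) acc =
        acc ++ l.flatten by simp [h]
    intro l
    induction l with
    | nil => simp
    | cons b l ih => intro acc; simp [ih]
  rw [h]
  refine PT.foldl (step := fun _ acc a => acc ++ a) (by fun_prop) hl (by fun_prop) ?_
  obtain ⟨T, hT⟩ := hl.exists_esize_le
  refine ⟨T, fun x s a ha => ?_⟩
  have h1 := esize_le_of_mem ha
  have h2 := hT x
  have h3 := esize_append s a
  omega

@[fun_prop]
theorem PT.pairs {l : α → List β} {l' : α → List γ} (hl : PT l) (hl' : PT l') :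
    PT (fun x => pairs (l x) (l' x)) := by
  unfold BoxApprox.pairs
  fun_prop

/-! ### Natural numbers -/

@[fun_prop]
theorem PT.length {l : α → List β} (hl : PT l) : PT (fun x => (l x).length) := by
  -- A list of units has the encoding of its length in unary, so arithmetic reduces to list
  -- operations.
  refine PT.of_enc (f := fun x => (l x).map fun _ => ()) (by fun_prop) fun x => ?_
  induction l x with
  | nil => rfl
  | cons b l ih => rw [List.length_cons, enc_succ, ih]; rfl

theorem enc_replicate (n : ℕ) : enc (List.replicate n ()) = enc n := by
  induction n with
  | zero => rfl
  | succ n ih => rw [List.replicate_succ, enc_succ, enc_list_cons, ih]; rfl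

@[fun_prop]
theorem PT.replicate {f : α → ℕ} (hf : PT f) : PT (fun x => List.replicate (f x) ()) :=
  PT.of_enc hf fun x => enc_replicate (f x)

@[fun_prop]
theorem PT.add {f g : α → ℕ} (hf : PT f) (hg : PT g) : PT (fun x => f x + g x) := by
  have h : (fun x => f x + g x) =
      fun x => (List.replicate (f x) () ++ List.replicate (g x) ()).length := by
    funext x; simp
  rw [h]; fun_prop

@[fun_prop]
theorem PT.mul {f g : α → ℕ} (hf : PT f) (hg : PT g) : PT (fun x => f x * g x) := by
  have h : (fun x => f x * g x) =
      fun x => ((List.replicate (f x) ()).map fun _ => List.replicate (g x) ()).flatten.length := by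
    funext x; simp
  rw [h]; fun_prop

/-- Iteration of a function that does not enlarge its argument. -/
theorem PT.iterate {f : α → σ → σ} {n : α → ℕ} {init : α → σ}
    (hf : PT (fun z : α × σ => f z.1 z.2)) (hn : PT n) (hi : PT init)
    (hle : ∀ x s, esize (f x s) ≤ esize s) : PT (fun x => (f x)^[n x] (init x)) := by
  have h : (fun x => (f x)^[n x] (init x)) =
      fun x => (List.replicate (n x) ()).foldl (fun s _ => f x s) (init x) := by
    funext x
    suffices h : ∀ (n : ℕ) (s : σ), (f x)^[n] s =
        (List.replicate n ()).foldl (fun s _ => f x s) s from h _ _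
    intro n
    induction n with
    | zero => intro s; rfl
    | succ n ih => intro s; rw [Function.iterate_succ_apply, List.replicate_succ, ih]; rfl
  rw [h]
  refine PT.foldl (step := fun x s _ => f x s)
    (hf.comp (f := fun z : α × σ × Unit => (z.1, z.2.1)) (by fun_prop)) (by fun_prop) hi
    ⟨0, fun x s a _ => ?_⟩
  simpa using hle x s

@[fun_prop]
theorem PT.drop {l : α → List β} {n : α → ℕ} (hl : PT l) (hn : PT n) :
    PT (fun x => (l x).drop (n x)) := by
  have h : (fun x => (l x).drop (n x)) = fun x => List.tail^[n x] (l x) := by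
    funext x
    suffices h : ∀ (n : ℕ) (l : List β), l.drop n = List.tail^[n] l from h _ _
    intro n
    induction n with
    | zero => intro l; rfl
    | succ n ih => intro l; rw [Function.iterate_succ_apply, ← ih, List.drop_tail]
  rw [h]
  refine PT.iterate (f := fun _ s => List.tail s) (by fun_prop) hn hl fun x s => ?_
  cases s <;> simp
  omega

@[fun_prop]
theorem PT.getD {l : α → List β} {n : α → ℕ} {d : α → β} (hl : PT l) (hn : PT n) (hd : PT d) :
    PT (fun x => (l x).getD (n x) (d x)) := by
  have h : (fun x => (l x).getD (n x) (d x)) = fun x => ((l x).drop (n x)).headD (d x) := by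
    funext x
    rw [List.headD_eq_head?_getD, List.head?_drop, List.getD_eq_getElem?_getD]
  rw [h]; fun_prop

@[fun_prop]
theorem PT.lt {f g : α → ℕ} (hf : PT f) (hg : PT g) : PT (fun x => decide (f x < g x)) := by
  have h : (fun x => decide (f x < g x)) =
      fun x => !((List.replicate (g x) ()).drop (f x)).isEmpty := by
    funext x
    rw [Bool.eq_iff_iff]
    simp [Nat.sub_eq_zero_iff_le]
  rw [h]; fun_prop

@[fun_prop]
theorem PT.le {f g : α → ℕ} (hf : PT f) (hg : PT g) : PT (fun x => decide (f x ≤ g x)) := by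
  have h : (fun x => decide (f x ≤ g x)) = fun x => decide (f x < g x + 1) := by
    funext x; simp
  rw [h]; fun_prop

@[fun_prop]
theorem PT.beq {f g : α → ℕ} (hf : PT f) (hg : PT g) : PT (fun x => f x == g x) := by
  have h : (fun x => f x == g x) = fun x => decide (f x ≤ g x) && decide (g x ≤ f x) := by
    funext x
    rw [Bool.eq_iff_iff, beq_iff_eq, Bool.and_eq_true, decide_eq_true_iff, decide_eq_true_iff]
    exact le_antisymm_iff
  rw [h]; fun_prop

@[fun_prop]
theorem PT.range {n : α → ℕ} (hn : PT n) : PT (fun x => List.range (n x)) := by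
  have key : ∀ (n : ℕ), (List.replicate n ()).foldl (fun acc _ => acc.length :: acc) [] =
      (List.range n).reverse := by
    intro n
    induction n with
    | zero => rfl
    | succ n ih => rw [List.replicate_succ', List.foldl_append, ih, List.range_succ]; simp
  have h : (fun x => List.range (n x)) = fun x =>
      ((List.replicate (n x) ()).foldl (fun acc _ => acc.length :: acc) []).reverse := by
    funext x
    rw [key, List.reverse_reverse]
  rw [h]
  refine PT.reverse (PT.foldl_of_bound (step := fun _ acc _ => acc.length :: acc) (by fun_prop)
    (by fun_prop) (by fun_prop) ?_)
  obtain ⟨T, hT⟩ := hn.exists_esize_le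
  refine ⟨T * (2 * T + 2) + 1, fun x i hi => ?_⟩
  rw [List.take_replicate, key]
  have h1 : ∀ i, esize (List.range i).reverse ≤ i * (2 * i + 2) + 1 := by
    intro i
    induction i with
    | zero => simp
    | succ i ih =>
      rw [List.range_succ, List.reverse_append, List.reverse_singleton, List.singleton_append,
        esize_list_cons, esize_nat]
      nlinarith
  have h2 := hT x
  rw [esize_nat] at h2
  have h3 : min i (n x) ≤ T.eval (esize x) := by omega
  refine (h1 _).trans ?_
  simp only [Polynomial.eval_add, Polynomial.eval_mul, Polynomial.eval_ofNat, Polynomial.eval_one]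
  gcongr

end


/-! ### The algorithm on positions -/

/-- At least two of four truth values are true. -/
def twoOf (a b c d : Bool) : Bool := (a && b) || (c && d) || ((a || b) && (c || d))

theorem twoOf_iff {a b c d : Prop} [Decidable a] [Decidable b] [Decidable c] [Decidable d] :
    twoOf (decide a) (decide b) (decide c) (decide d) = true ↔
      (a ∧ b) ∨ (c ∧ d) ∨ ((a ∨ b) ∧ (c ∨ d)) := by
  simp [twoOf, or_assoc]

/-- The position of the start point of an arc. -/
def startPos (L : List (ℕ × ℕ)) (v : ℕ) : ℕ := (L.getD v (0, 0)).1

/-- The position of the end point of an arc. -/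
def endPos (L : List (ℕ × ℕ)) (v : ℕ) : ℕ := (L.getD v (0, 0)).2

/-- The arcs of `u` and `v` meet. -/
def near (L : List (ℕ × ℕ)) (u v : ℕ) : Bool :=
  twoOf (decide (startPos L u ≤ endPos L v)) (decide (startPos L v ≤ endPos L u))
    (decide (endPos L u < startPos L u)) (decide (endPos L v < startPos L v))

/-- The order of the positions when the circle is cut in the gap following the position `j`. -/
def cutKey (L : List (ℕ × ℕ)) (j r : ℕ) : ℕ := bif decide (j < r) then r else r + 2 * L.length

/-- The start point of an arc after cutting the circle. -/
def startKey (L : List (ℕ × ℕ)) (j v : ℕ) : ℕ := cutKey L j (startPos L v)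

/-- The end point of an arc after cutting the circle. -/
def endKey (L : List (ℕ × ℕ)) (j v : ℕ) : ℕ := cutKey L j (endPos L v)

/-- The arc of `v` passes through the gap following the position `j`. -/
def onGap (L : List (ℕ × ℕ)) (j v : ℕ) : Bool := decide (endKey L j v < startKey L j v)

/-- No two arcs through the gap form a circle cover pair. -/
def goodGap (L : List (ℕ × ℕ)) (j : ℕ) : Bool :=
  (List.range L.length).all fun u => (List.range L.length).all fun v =>
    !onGap L j u || !onGap L j v || decide (endKey L j u < startKey L j v)

/-- The occurring positions. -/
def positions (L : List (ℕ × ℕ)) : List ℕ := (L.map fun x => x.1) ++ L.map fun x => x.2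

/-- An admissible gap. -/
def firstGap (L : List (ℕ × ℕ)) : ℕ := ((positions L).filter fun j => goodGap L j).headD 0

/-- The end point of `a` is the farthest one of the arcs through the gap `j`. -/
def isFarthest (L : List (ℕ × ℕ)) (j a : ℕ) : Bool :=
  onGap L j a && (List.range L.length).all fun c => !onGap L j c || decide (endKey L j c ≤ endKey L j a)

/-- The gap following the farthest end point of the arcs through the gap `j`. -/
def secondGap (L : List (ℕ × ℕ)) (j : ℕ) : ℕ :=
  endPos L (((List.range L.length).filter fun a => isFarthest L j a).headD 0)

/-- The ordered pairs of vertices. -/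
def vertexPairs (L : List (ℕ × ℕ)) : List (ℕ × ℕ) :=
  pairs (List.range L.length) (List.range L.length)

/-- The pair `e` of nonadjacent vertices lies entirely before the pair `e'`. -/
def below (L : List (ℕ × ℕ)) (j : ℕ) (e e' : ℕ × ℕ) : Bool :=
  decide (startKey L j e.2 ≤ endKey L j e'.1) && decide (startKey L j e.1 ≤ endKey L j e'.2)

/-- The nonadjacent pairs of a vertex at the gap `j` and one at the gap `k`. -/
def crossPairs (L : List (ℕ × ℕ)) (j k : ℕ) : List (ℕ × ℕ) :=
  (vertexPairs L).filter fun e => onGap L j e.1 && onGap L k e.2 && !near L e.1 e.2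

/-- Remove the minimal pairs. -/
def peel (L : List (ℕ × ℕ)) (j : ℕ) (R : List (ℕ × ℕ)) : List (ℕ × ℕ) :=
  R.filter fun e => R.any fun e' => below L j e' e

/-- The pairs that remain after `i` rounds of peeling. -/
def layer (L : List (ℕ × ℕ)) (j k i : ℕ) : List (ℕ × ℕ) := (peel L j)^[i] (crossPairs L j k)

/-- The nonempty ones among the layers. -/
def layers (L : List (ℕ × ℕ)) (j k : ℕ) : List (List (ℕ × ℕ)) :=
  ((List.range (L.length * L.length)).map fun i => layer L j k i).filter fun R => !R.isEmpty

/-- The interval order covering the minimal elements of a layer. -/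
def layerRel (L : List (ℕ × ℕ)) (j k : ℕ) (R : List (ℕ × ℕ)) (u v : ℕ) : Bool :=
  onGap L j u && onGap L k v && !near L u v && (R.all fun e => !below L j e (u, v)) &&
    R.any fun e => decide (startKey L j e.2 ≤ startKey L j v) &&
      decide (startKey L j e.1 ≤ startKey L j u)

/-- The interval order of the arcs that avoid a gap. -/
def cutRel (L : List (ℕ × ℕ)) (j u v : ℕ) : Bool :=
  !onGap L j u && !onGap L j v && decide (endKey L j u < startKey L j v)

/-- Two nonadjacent pairs are ordered alike in every interval model. -/
def forced (L : List (ℕ × ℕ)) (e e' : ℕ × ℕ) : Bool :=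
  !near L e.1 e.2 && !near L e'.1 e'.2 && near L e.1 e'.1 && near L e.2 e'.2

/-- The label of an ordered pair. -/
def labelAt (n : ℕ) (c : List ℕ) (u v : ℕ) : ℕ := c.getD (u * n + v) 0

/-- Identify the labels `x` and `y`. -/
def mergeLabels (c : List ℕ) (x y : ℕ) : List ℕ :=
  c.map fun l => bif l == x || l == y then (bif decide (x < y) then x else y) else l

/-- Identify the labels of a forced pair of pairs. -/
def labelStep (L : List (ℕ × ℕ)) (c : List ℕ) (q : (ℕ × ℕ) × (ℕ × ℕ)) : List ℕ :=
  bif forced L q.1 q.2 then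
    mergeLabels c (labelAt L.length c q.1.1 q.1.2) (labelAt L.length c q.2.1 q.2.2)
  else c

/-- The labels of the classes of the forcing relation. -/
def labels (L : List (ℕ × ℕ)) : List ℕ :=
  (pairs (vertexPairs L) (vertexPairs L)).foldl (labelStep L) (List.range (L.length * L.length))

/-- The label of the class of an ordered pair. -/
def classOf (L : List (ℕ × ℕ)) (u v : ℕ) : ℕ := labelAt L.length (labels L) u v

/-- Some class contains a pair and its reversal. -/
def conflict (L : List (ℕ × ℕ)) : Bool :=
  (List.range L.length).any fun u => (List.range L.length).any fun v =>
    !near L u v && classOf L u v == classOf L v u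

/-- The lexicographic orientation. -/
def lexRel (L : List (ℕ × ℕ)) (u v : ℕ) : Bool :=
  !near L u v && decide (classOf L u v < classOf L v u)

/-- The interval model of an interval order. -/
def orderModel (n : ℕ) (rel : ℕ → ℕ → Bool) : List (ℕ × ℕ) :=
  (List.range n).map fun v => (2 * ((List.range n).filter fun w => rel w v).length + 1,
    2 * ((List.range n).filter fun w =>
      (List.range n).all fun x => !rel v x || rel w x).length)

/-- The output of the algorithm for a graph that is not an interval graph. -/
def mainOutput (L : List (ℕ × ℕ)) (j k : ℕ) : List (List (ℕ × ℕ)) :=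
  ((layers L j k).map fun R => orderModel L.length (layerRel L j k R)) ++
    [orderModel L.length (cutRel L j), orderModel L.length (cutRel L k)]

/-- The whole algorithm. -/
def algorithm (L : List (ℕ × ℕ)) : List (List (ℕ × ℕ)) :=
  bif conflict L then mainOutput L (firstGap L) (secondGap L (firstGap L))
  else [orderModel L.length (lexRel L)]

/-! ### The algorithm takes polynomial time -/

section
variable {α : Type*} [Enc α] {L : α → List (ℕ × ℕ)} {j k r i u v : α → ℕ} {e e' : α → ℕ × ℕ}
  {R : α → List (ℕ × ℕ)}

@[fun_prop]
theorem PT.twoOf {a b c d : α → Bool} (ha : PT a) (hb : PT b) (hc : PT c) (hd : PT d) :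
    PT (fun x => twoOf (a x) (b x) (c x) (d x)) := by
  unfold BoxApprox.twoOf; fun_prop

@[fun_prop]
theorem PT.startPos (hL : PT L) (hv : PT v) : PT (fun x => startPos (L x) (v x)) := by
  unfold BoxApprox.startPos; fun_prop

@[fun_prop]
theorem PT.endPos (hL : PT L) (hv : PT v) : PT (fun x => endPos (L x) (v x)) := by
  unfold BoxApprox.endPos; fun_prop

@[fun_prop]
theorem PT.near (hL : PT L) (hu : PT u) (hv : PT v) : PT (fun x => near (L x) (u x) (v x)) := by
  unfold BoxApprox.near; fun_prop

@[fun_prop]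
theorem PT.cutKey (hL : PT L) (hj : PT j) (hr : PT r) :
    PT (fun x => cutKey (L x) (j x) (r x)) := by
  unfold BoxApprox.cutKey; fun_prop

@[fun_prop]
theorem PT.startKey (hL : PT L) (hj : PT j) (hv : PT v) :
    PT (fun x => startKey (L x) (j x) (v x)) := by
  unfold BoxApprox.startKey; fun_prop

@[fun_prop]
theorem PT.endKey (hL : PT L) (hj : PT j) (hv : PT v) :
    PT (fun x => endKey (L x) (j x) (v x)) := by
  unfold BoxApprox.endKey; fun_prop

@[fun_prop]
theorem PT.onGap (hL : PT L) (hj : PT j) (hv : PT v) :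
    PT (fun x => onGap (L x) (j x) (v x)) := by
  unfold BoxApprox.onGap; fun_prop

@[fun_prop]
theorem PT.goodGap (hL : PT L) (hj : PT j) : PT (fun x => goodGap (L x) (j x)) := by
  unfold BoxApprox.goodGap; fun_prop

@[fun_prop]
theorem PT.positions (hL : PT L) : PT (fun x => positions (L x)) := by
  unfold BoxApprox.positions; fun_prop

@[fun_prop]
theorem PT.firstGap (hL : PT L) : PT (fun x => firstGap (L x)) := by
  unfold BoxApprox.firstGap; fun_prop

@[fun_prop]
theorem PT.isFarthest (hL : PT L) (hj : PT j) (hv : PT v) :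
    PT (fun x => isFarthest (L x) (j x) (v x)) := by
  unfold BoxApprox.isFarthest; fun_prop

@[fun_prop]
theorem PT.secondGap (hL : PT L) (hj : PT j) : PT (fun x => secondGap (L x) (j x)) := by
  unfold BoxApprox.secondGap; fun_prop

@[fun_prop]
theorem PT.vertexPairs (hL : PT L) : PT (fun x => vertexPairs (L x)) := by
  unfold BoxApprox.vertexPairs; fun_prop

@[fun_prop]
theorem PT.below (hL : PT L) (hj : PT j) (he : PT e) (he' : PT e') :
    PT (fun x => below (L x) (j x) (e x) (e' x)) := by
  unfold BoxApprox.below; fun_prop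

@[fun_prop]
theorem PT.crossPairs (hL : PT L) (hj : PT j) (hk : PT k) :
    PT (fun x => crossPairs (L x) (j x) (k x)) := by
  unfold BoxApprox.crossPairs; fun_prop

@[fun_prop]
theorem PT.peel (hL : PT L) (hj : PT j) (hR : PT R) : PT (fun x => peel (L x) (j x) (R x)) := by
  unfold BoxApprox.peel; fun_prop

@[fun_prop]
theorem PT.layer (hL : PT L) (hj : PT j) (hk : PT k) (hi : PT i) :
    PT (fun x => layer (L x) (j x) (k x) (i x)) := by
  unfold BoxApprox.layer
  exact PT.iterate (f := fun x R => BoxApprox.peel (L x) (j x) R) (by fun_prop) hi (by fun_prop)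
    fun x s => esize_filter_le _ _

@[fun_prop]
theorem PT.layers (hL : PT L) (hj : PT j) (hk : PT k) :
    PT (fun x => layers (L x) (j x) (k x)) := by
  unfold BoxApprox.layers; fun_prop

@[fun_prop]
theorem PT.layerRel (hL : PT L) (hj : PT j) (hk : PT k) (hR : PT R) (hu : PT u) (hv : PT v) :
    PT (fun x => layerRel (L x) (j x) (k x) (R x) (u x) (v x)) := by
  unfold BoxApprox.layerRel; fun_prop

@[fun_prop]
theorem PT.cutRel (hL : PT L) (hj : PT j) (hu : PT u) (hv : PT v) :
    PT (fun x => cutRel (L x) (j x) (u x) (v x)) := by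
  unfold BoxApprox.cutRel; fun_prop

@[fun_prop]
theorem PT.forced (hL : PT L) (he : PT e) (he' : PT e') :
    PT (fun x => forced (L x) (e x) (e' x)) := by
  unfold BoxApprox.forced; fun_prop

@[fun_prop]
theorem PT.labelAt {n : α → ℕ} {c : α → List ℕ} (hn : PT n) (hc : PT c) (hu : PT u) (hv : PT v) :
    PT (fun x => labelAt (n x) (c x) (u x) (v x)) := by
  unfold BoxApprox.labelAt; fun_prop

@[fun_prop]
theorem PT.mergeLabels {c : α → List ℕ} (hc : PT c) (hu : PT u) (hv : PT v) :
    PT (fun x => mergeLabels (c x) (u x) (v x)) := by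
  unfold BoxApprox.mergeLabels; fun_prop

@[fun_prop]
theorem PT.labelStep {c : α → List ℕ} {q : α → (ℕ × ℕ) × (ℕ × ℕ)} (hL : PT L) (hc : PT c)
    (hq : PT q) : PT (fun x => labelStep (L x) (c x) (q x)) := by
  unfold BoxApprox.labelStep; fun_prop

/-- Merging keeps the smaller of the two labels, so no entry grows; the fold computing `labels`
therefore never enlarges its state. -/
theorem esize_mergeLabels_le (c : List ℕ) (x y : ℕ) : esize (mergeLabels c x y) ≤ esize c := by
  unfold mergeLabels
  induction c with
  | nil => simp
  | cons l c ih =>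
    rw [List.map_cons, esize_list_cons, esize_list_cons]
    have h : (bif l == x || l == y then (bif decide (x < y) then x else y) else l) ≤ l := by
      cases h : (l == x || l == y)
      · simp
      · rcases lt_or_ge x y with hxy | hxy
        · simp [hxy]
          simp at h; omega
        · simp [hxy.not_gt]
          simp at h; omega
    simp only [esize_nat]
    omega

@[fun_prop]
theorem PT.labels (hL : PT L) : PT (fun x => labels (L x)) := by
  unfold BoxApprox.labels
  refine PT.foldl (step := fun x => BoxApprox.labelStep (L x)) (by fun_prop) (by fun_prop)
    (by fun_prop) ⟨0, fun x s a _ => ?_⟩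
  unfold BoxApprox.labelStep
  cases BoxApprox.forced (L x) a.1 a.2
  · simp
  · simpa using esize_mergeLabels_le _ _ _

@[fun_prop]
theorem PT.classOf (hL : PT L) (hu : PT u) (hv : PT v) :
    PT (fun x => classOf (L x) (u x) (v x)) := by
  unfold BoxApprox.classOf; fun_prop

@[fun_prop]
theorem PT.conflict (hL : PT L) : PT (fun x => conflict (L x)) := by
  unfold BoxApprox.conflict; fun_prop

@[fun_prop]
theorem PT.lexRel (hL : PT L) (hu : PT u) (hv : PT v) :
    PT (fun x => lexRel (L x) (u x) (v x)) := by
  unfold BoxApprox.lexRel; fun_prop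

theorem PT.orderModel {n : α → ℕ} {rel : α → ℕ → ℕ → Bool} (hn : PT n)
    (hrel : PT (fun z : α × ℕ × ℕ => rel z.1 z.2.1 z.2.2)) :
    PT (fun x => orderModel (n x) (rel x)) := by
  have h : ∀ {β : Type _} [Enc β] {f : β → α} {u v : β → ℕ}, PT f → PT u → PT v →
      PT (fun y => rel (f y) (u y) (v y)) := fun hf hu hv => hrel.comp (hf.pair (hu.pair hv))
  unfold BoxApprox.orderModel
  refine PT.map (PT.pair (PT.add (PT.mul (by fun_prop) (PT.length (PT.filter ?_ (by fun_prop))))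
    (by fun_prop)) (PT.mul (by fun_prop) (PT.length (PT.filter (PT.all (PT.or (PT.not ?_) ?_)
    (by fun_prop)) (by fun_prop))))) (by fun_prop)
  all_goals exact h (by fun_prop) (by fun_prop) (by fun_prop)

@[fun_prop]
theorem PT.mainOutput (hL : PT L) (hj : PT j) (hk : PT k) :
    PT (fun x => mainOutput (L x) (j x) (k x)) := by
  unfold BoxApprox.mainOutput
  refine PT.append (PT.map (PT.orderModel (by fun_prop) (by fun_prop)) (by fun_prop))
    (PT.cons (PT.orderModel (by fun_prop) (by fun_prop))
      (PT.cons (PT.orderModel (by fun_prop) (by fun_prop)) (by fun_prop)))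

theorem PT.algorithm : PT algorithm := by
  unfold BoxApprox.algorithm
  exact PT.cond (by fun_prop) (by fun_prop)
    (PT.cons (PT.orderModel (by fun_prop) (by fun_prop)) (by fun_prop))

end


/-! ### Interval models, extensions and boxicity -/

theorem IntervalModel.adj_iff {V : Type*} (I : IntervalModel V) {u v : V} :
    I.graph.Adj u v ↔ u ≠ v ∧ I.left u ≤ I.right v ∧ I.left v ≤ I.right u := by
  have hu := I.left_lt_right u
  have hv := I.left_lt_right v
  simp only [IntervalModel.graph, IntervalModel.interval, Set.Icc_inter_Icc, Set.nonempty_Icc,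
    sup_le_iff, le_inf_iff]
  constructor
  · rintro ⟨h, ⟨-, h1⟩, h2, -⟩
    exact ⟨h, h2, h1⟩
  · rintro ⟨h, h1, h2⟩
    exact ⟨h, ⟨hu.le, h2⟩, h1, hv.le⟩

/-- The interval given to a vertex outside `S` contains all the others, so these vertices become
universal. -/
theorem IsExtension.adj_iff {V : Type*} {S : Set V} {I : IntervalModel S} {I' : IntervalModel V}
    (h : IsExtension I I') {u v : V} (huv : u ≠ v) :
    I'.graph.Adj u v ↔ ∀ (hu : u ∈ S) (hv : v ∈ S), I.graph.Adj ⟨u, hu⟩ ⟨v, hv⟩ := by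
  obtain ⟨l, r, ⟨hl, hl'⟩, ⟨hr, hr'⟩, h1, h2⟩ := h
  obtain ⟨a, rfl⟩ := hl
  obtain ⟨b, rfl⟩ := hr
  have hL : ∀ v : S, I.left a ≤ I.left v := fun v => hl' ⟨v, rfl⟩
  have hR : ∀ v : S, I.right v ≤ I.right b := fun v => hr' ⟨v, rfl⟩
  have hlr : I.left a ≤ I.right b := (I.left_lt_right a).le.trans (hR a)
  rw [IntervalModel.adj_iff]
  by_cases hu : u ∈ S <;> by_cases hv : v ∈ S
  · have := h1 ⟨u, hu⟩
    have := h1 ⟨v, hv⟩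
    simp_all [IntervalModel.adj_iff]
  · have h3 := h1 ⟨u, hu⟩
    have h4 := h2 v hv
    simp only [hv, IsEmpty.forall_iff, implies_true, iff_true]
    rw [h3.1, h3.2, h4.1, h4.2]
    exact ⟨huv, (I.left_lt_right _).le.trans (hR _), (hL _).trans (I.left_lt_right _).le⟩
  · have h3 := h1 ⟨v, hv⟩
    have h4 := h2 u hu
    simp only [hu, IsEmpty.forall_iff, iff_true]
    rw [h3.1, h3.2, h4.1, h4.2]
    exact ⟨huv, (hL _).trans (I.left_lt_right _).le, (I.left_lt_right _).le.trans (hR _)⟩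
  · have h3 := h2 v hv
    have h4 := h2 u hu
    simp only [hu, IsEmpty.forall_iff, iff_true]
    rw [h3.1, h3.2, h4.1, h4.2]
    exact ⟨huv, hlr, hlr⟩

theorem exists_isExtension {V : Type*} [Finite V] {S : Set V} (hS : S.Nonempty)
    (I : IntervalModel S) : ∃ I', IsExtension I I' := by
  classical
  have : Nonempty S := hS.to_subtype
  obtain ⟨a, ha⟩ := Finite.exists_min I.left
  obtain ⟨b, hb⟩ := Finite.exists_max I.right
  refine ⟨⟨fun v => if h : v ∈ S then I.left ⟨v, h⟩ else I.left a,
    fun v => if h : v ∈ S then I.right ⟨v, h⟩ else I.right b, fun v => ?_⟩,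
    I.left a, I.right b, ⟨⟨a, rfl⟩, ?_⟩, ⟨⟨b, rfl⟩, ?_⟩, fun v => by simp, fun v hv => by simp [hv]⟩
  · split_ifs with h
    · exact I.left_lt_right _
    · exact (I.left_lt_right a).trans_le (hb a)
  · rintro _ ⟨v, rfl⟩; exact ha v
  · rintro _ ⟨v, rfl⟩; exact hb v

theorem exists_isBoxRep {V : Type*} [Finite V] (G : SimpleGraph V) :
    ∃ L : List (IntervalModel V), IsBoxRep L G := by
  classical
  have := Fintype.ofFinite V
  -- One model per nonedge: `e.1` gets `[0, 1]`, `e.2` gets `[3, 4]` and every other vertex `[0,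
  -- 4]`. The clause `v ≠ e.2` keeps the intervals nondegenerate when `e.1 = e.2`.
  let I : V × V → IntervalModel V := fun e =>
    ⟨fun v => if v = e.2 then 3 else 0, fun v => if v = e.1 ∧ v ≠ e.2 then 1 else 4, fun v => by
      by_cases h1 : v = e.2 <;> by_cases h2 : v = e.1 <;> simp [h1, h2] <;> norm_num
      split_ifs <;> norm_num⟩
  refine ⟨((Finset.univ : Finset (V × V)).filter fun e => e.1 ≠ e.2 ∧ ¬ G.Adj e.1 e.2).toList.map I,
    fun u v huv => ?_⟩
  have hI : ∀ e : V × V, e.1 ≠ e.2 → ∀ u v, u ≠ v → ((I e).graph.Adj u v ↔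
      ¬ ((u = e.1 ∧ v = e.2) ∨ (u = e.2 ∧ v = e.1))) := by
    intro e he u v huv
    rw [IntervalModel.adj_iff]
    simp only [I]
    grind
  constructor
  · intro h J hJ
    obtain ⟨e, he, rfl⟩ := List.mem_map.1 hJ
    have he' := (Finset.mem_filter.1 (Finset.mem_toList.1 he)).2
    rw [hI e he'.1 u v huv]
    rintro (⟨rfl, rfl⟩ | ⟨rfl, rfl⟩)
    · exact he'.2 h
    · exact he'.2 h.symm
  · intro h
    by_contra hG
    have := h (I (u, v)) (List.mem_map.2 ⟨(u, v), by simp [huv, hG], rfl⟩)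
    rw [hI _ huv u v huv] at this
    exact this (.inl ⟨rfl, rfl⟩)

theorem exists_isOptimalBoxRep {V : Type*} [Finite V] (G : SimpleGraph V) :
    ∃ L : List (IntervalModel V), IsOptimalBoxRep L G := by
  classical
  have h : ∃ k, ∃ L : List (IntervalModel V), L.length = k ∧ IsBoxRep L G :=
    let ⟨L, hL⟩ := exists_isBoxRep G
    ⟨_, L, rfl, hL⟩
  obtain ⟨L, hL, hL'⟩ := Nat.find_spec h
  exact ⟨L, hL', fun L' h' => hL ▸ Nat.find_min' h ⟨L', rfl, h'⟩⟩

theorem boxicity_le {V : Type*} {G : SimpleGraph V} {L : List (IntervalModel V)}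
    (h : IsBoxRep L G) : boxicity G ≤ L.length :=
  Nat.sInf_le ⟨L, rfl, h⟩

theorem IsOptimalBoxRep.length_eq {V : Type*} {G : SimpleGraph V} {L : List (IntervalModel V)}
    (h : IsOptimalBoxRep L G) : L.length = boxicity G := by
  refine le_antisymm ?_ (boxicity_le h.1)
  obtain ⟨L', hL', h'⟩ := Nat.sInf_mem (s := {k | ∃ L : List (IntervalModel V),
    L.length = k ∧ IsBoxRep L G}) ⟨_, L, rfl, h.1⟩
  exact (h.2 L' h').trans hL'.le

theorem boxicity_induce_le {V : Type*} [Finite V] (G : SimpleGraph V) (S : Set V) :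
    boxicity (G.induce S) ≤ boxicity G := by
  obtain ⟨L, hL⟩ := exists_isOptimalBoxRep G
  let f : IntervalModel V → IntervalModel S := fun I =>
    ⟨fun v => I.left v, fun v => I.right v, fun v => I.left_lt_right v⟩
  rw [← hL.length_eq, ← List.length_map f]
  refine boxicity_le fun u v huv => ?_
  have huv' : (u : V) ≠ v := fun h => huv (Subtype.ext h)
  rw [SimpleGraph.comap_adj, Function.Embedding.subtype_apply, Function.Embedding.subtype_apply,
    hL.1 u v huv']
  simp only [List.mem_map, forall_exists_index, and_imp, forall_apply_eq_imp_iff₂,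
    IntervalModel.adj_iff, ne_eq, huv, huv', not_false_iff, true_and, f]

theorem isIntervalGraph_of_isClique {V : Type*} {G : SimpleGraph V}
    (h : ∀ u v, u ≠ v → G.Adj u v) : IsIntervalGraph G := by
  refine ⟨⟨fun _ => 0, fun _ => 1, fun _ => zero_lt_one⟩, ?_⟩
  ext u v
  rw [IntervalModel.adj_iff]
  exact ⟨fun h' => h u v h'.1, fun h' => ⟨h'.ne, zero_le_one, zero_le_one⟩⟩

/-! ### Coordinates on the circle -/

theorem coord_nonneg (x : Circ) : 0 ≤ coord x := (AddCircle.equivIco (1 : ℝ) 0 x).2.1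

theorem coord_lt_one (x : Circ) : coord x < 1 := by
  simpa [coord] using (AddCircle.equivIco (1 : ℝ) 0 x).2.2

@[simp] theorem coe_coord (x : Circ) : ((coord x : ℝ) : Circ) = x :=
  AddCircle.coe_equivIco

theorem coord_coe {r : ℝ} (h0 : 0 ≤ r) (h1 : r < 1) : coord (r : Circ) = r := by
  unfold coord
  rw [AddCircle.equivIco_coe_eq (by simpa using ⟨h0, h1⟩)]

theorem coord_injective : Function.Injective coord := fun x y h => by
  rw [← coe_coord x, h, coe_coord]

@[simp] theorem coord_zero : coord 0 = 0 := by simpa using coord_coe le_rfl zero_lt_one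

theorem coord_sub (x y : Circ) :
    coord (x - y) = if coord y ≤ coord x then coord x - coord y else coord x - coord y + 1 := by
  have hx := coord_nonneg x
  have hy := coord_nonneg y
  have hx' := coord_lt_one x
  have hy' := coord_lt_one y
  split_ifs with h
  · rw [← coord_coe (r := coord x - coord y) (by linarith) (by linarith)]
    simp
  · rw [← coord_coe (r := coord x - coord y + 1) (by linarith) (by linarith)]
    simp

theorem coord_pos {x : Circ} (h : x ≠ 0) : 0 < coord x :=
  (coord_nonneg x).lt_of_ne fun h' => h (coord_injective (by rw [← h', coord_zero]))

theorem mem_cIcc_iff {s t x : Circ} (h : s ≠ t) :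
    x ∈ Set.cIcc s t ↔ coord (x - s) ≤ coord (t - s) := by
  -- The cyclic order reads this difference in `(0, 1]` and the other one in `[0, 1)`; the two
  -- readings agree away from `0`.
  have h1 : (QuotientAddGroup.equivIocMod (Fact.out : (0 : ℝ) < 1) 0 (t - s) : ℝ) =
      coord (t - s) := by
    have h2 : 0 < coord (t - s) := coord_pos (sub_ne_zero.2 h.symm)
    conv_lhs => rw [← coe_coord (t - s)]
    exact (toIocMod_eq_self _).2 ⟨h2, by simpa using (coord_lt_one _).le⟩
  rw [← h1]
  exact Iff.rfl

/-- The coordinate of `x` when the circle is cut at `p`. -/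
noncomputable def pos (p x : Circ) : ℝ := coord (x - p)

theorem pos_nonneg (p x : Circ) : 0 ≤ pos p x := coord_nonneg _

theorem pos_lt_one (p x : Circ) : pos p x < 1 := coord_lt_one _

@[simp] theorem pos_self (p : Circ) : pos p p = 0 := by simp [pos]

theorem pos_injective (p : Circ) : Function.Injective (pos p) := fun _ _ h =>
  sub_left_injective (coord_injective h)

/-- Seen from `p`, an arc is an ordinary interval or, when its end precedes its start, the
complement of an open interval. -/
theorem mem_cIcc_iff_pos (p : Circ) {s t x : Circ} (h : s ≠ t) :
    x ∈ Set.cIcc s t ↔ (pos p s ≤ pos p x ∧ pos p x ≤ pos p t) ∨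
      (pos p t < pos p s ∧ (pos p s ≤ pos p x ∨ pos p x ≤ pos p t)) := by
  have h1 : pos p s ≠ pos p t := fun h' => h (pos_injective p h')
  have hx := pos_nonneg p x
  have hs := pos_nonneg p s
  have ht := pos_nonneg p t
  have hx' := pos_lt_one p x
  have hs' := pos_lt_one p s
  have ht' := pos_lt_one p t
  rw [mem_cIcc_iff h, ← sub_sub_sub_cancel_right x s p, ← sub_sub_sub_cancel_right t s p,
    coord_sub (x - p), coord_sub (t - p)]
  change (if pos p s ≤ pos p x then pos p x - pos p s else pos p x - pos p s + 1) ≤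
    (if pos p s ≤ pos p t then pos p t - pos p s else pos p t - pos p s + 1) ↔ _
  split_ifs with h2 h3 h3
  · constructor
    · intro h4; left; constructor <;> linarith
    · rintro (h4 | h4) <;> linarith [h4.1, h4.2]
  · constructor
    · intro h4; right; exact ⟨not_le.1 h3, .inl h2⟩
    · intro _; linarith
  · constructor
    · intro h4; linarith
    · rintro (h4 | h4)
      · exact absurd h4.1 h2
      · linarith [h4.1]
  · constructor
    · intro h4; right; exact ⟨not_le.1 h3, .inr (by linarith)⟩
    · rintro (h4 | h4)
      · exact absurd h4.1 h2
      · rcases h4.2 with h5 | h5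
        · exact absurd h5 h2
        · linarith

/-! ### Cutting a circular arc model -/

/-- A description of a graph by the two end points of arcs of a circle that is cut at a point; `A`
is the set of the vertices whose arcs pass through this point. -/
structure IsCut {V X : Type*} [LinearOrder X] (G : SimpleGraph V) (A : Set V) (σ τ : V → X) :
    Prop where
  ne : ∀ v, σ v ≠ τ v
  mem_iff : ∀ v, v ∈ A ↔ τ v < σ v
  adj_iff : ∀ u v, G.Adj u v ↔ u ≠ v ∧ ((σ u ≤ τ v ∧ σ v ≤ τ u) ∨ (τ u < σ u ∧ τ v < σ v) ∨
    ((σ u ≤ τ v ∨ σ v ≤ τ u) ∧ (τ u < σ u ∨ τ v < σ v)))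

namespace CAModel

variable {V : Type*} (M : CAModel V)

theorem mem_arc_iff (p : Circ) {x : Circ} {v : V} :
    x ∈ M.arc v ↔ (pos p (M.s v) ≤ pos p x ∧ pos p x ≤ pos p (M.t v)) ∨
      (pos p (M.t v) < pos p (M.s v) ∧ (pos p (M.s v) ≤ pos p x ∨ pos p x ≤ pos p (M.t v))) :=
  mem_cIcc_iff_pos p (M.s_ne_t v)

theorem pos_ne (p : Circ) (v : V) : pos p (M.s v) ≠ pos p (M.t v) := fun h =>
  M.s_ne_t v (pos_injective p h)

/-- Arcs meet exactly if one contains the start of the other. In coordinates this says that at least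
two of four conditions hold: the two inequalities for intersecting intervals, and for each arc that
it wraps around. -/
theorem adj_iff_pos (p : Circ) {u v : V} :
    M.graph.Adj u v ↔ u ≠ v ∧ ((pos p (M.s u) ≤ pos p (M.t v) ∧ pos p (M.s v) ≤ pos p (M.t u)) ∨
      (pos p (M.t u) < pos p (M.s u) ∧ pos p (M.t v) < pos p (M.s v)) ∨
      ((pos p (M.s u) ≤ pos p (M.t v) ∨ pos p (M.s v) ≤ pos p (M.t u)) ∧
        (pos p (M.t u) < pos p (M.s u) ∨ pos p (M.t v) < pos p (M.s v)))) := by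
  change _ ∧ _ ↔ _
  refine and_congr_right fun huv => ?_
  constructor
  · rintro ⟨x, hx, hx'⟩
    rw [mem_arc_iff M p] at hx hx'
    grind
  · intro h
    suffices h : M.s u ∈ M.arc v ∨ M.s v ∈ M.arc u by
      have h1 : ∀ w, M.s w ∈ M.arc w := fun w => by
        rw [mem_arc_iff M p]
        have := M.pos_ne p w
        grind
      rcases h with h | h
      · exact ⟨_, h1 u, h⟩
      · exact ⟨_, h, h1 v⟩
    rw [mem_arc_iff M p, mem_arc_iff M p]
    grind

/-- The coordinate of the start point of an arc when the circle is cut at `p`; it lies in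
`(0, 1]`. -/
noncomputable def startPt (p : Circ) (v : V) : ℝ :=
  open Classical in if M.s v = p then 1 else pos p (M.s v)

/-- The coordinate of the end point of an arc when the circle is cut at `p`; it lies in
`[0, 1)`. -/
noncomputable def endPt (p : Circ) (v : V) : ℝ := pos p (M.t v)

theorem startPt_cases (p : Circ) (v : V) :
    (pos p (M.s v) = 0 ∧ M.startPt p v = 1) ∨
      (0 < pos p (M.s v) ∧ M.startPt p v = pos p (M.s v)) := by
  by_cases h : M.s v = p
  · left; simp [startPt, h]
  · right; exact ⟨coord_pos (sub_ne_zero.2 h), if_neg h⟩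

/-- An arc that starts at `p` passes through `p`; its start has to count as `1` rather than `0` for
membership to become a comparison of end points. -/
theorem mem_through_iff (p : Circ) {v : V} :
    v ∈ M.through p ↔ M.endPt p v < M.startPt p v := by
  change p ∈ M.arc v ↔ _
  rw [M.mem_arc_iff p, pos_self, endPt]
  have := M.startPt_cases p v
  have := pos_nonneg p (M.t v)
  have := pos_lt_one p (M.t v)
  have := M.pos_ne p v
  grind

theorem isCut (p : Circ) : IsCut M.graph (M.through p) (M.startPt p) (M.endPt p) where
  ne v := by
    have := M.startPt_cases p v
    have := pos_lt_one p (M.t v)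
    have := M.pos_ne p v
    rw [endPt]
    grind
  mem_iff _ := M.mem_through_iff p
  adj_iff u v := by
    rw [M.adj_iff_pos p, endPt, endPt]
    have := M.startPt_cases p u
    have := M.startPt_cases p v
    have := pos_nonneg p (M.t u)
    have := pos_nonneg p (M.t v)
    have := pos_lt_one p (M.t u)
    have := pos_lt_one p (M.t v)
    grind

theorem mem_arc_of_mem_through {p x : Circ} (hx : x ≠ p) {v : V} (hv : v ∈ M.through p) :
    x ∈ M.arc v ↔ M.startPt p v ≤ pos p x ∨ pos p x ≤ M.endPt p v := by
  rw [mem_through_iff] at hv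
  rw [M.mem_arc_iff p, endPt] at *
  have := M.startPt_cases p v
  have := pos_lt_one p x
  have := pos_nonneg p (M.t v)
  have : 0 < pos p x := coord_pos (sub_ne_zero.2 hx)
  grind

theorem pos_add {p : Circ} {m : ℝ} (h0 : 0 ≤ m) (h1 : m < 1) : pos p (p + (m : Circ)) = m := by
  rw [pos, add_sub_cancel_left, coord_coe h0 h1]

/-- An arc through `p` misses the open interval from its end to its start. Two such arcs cover the
circle exactly if the missed intervals are disjoint, that is, if one arc ends at or after the start
of the other. -/
theorem noCoverPairAt_iff {p : Circ} :
    M.NoCoverPairAt p ↔ ∀ u ∈ M.through p, ∀ v ∈ M.through p, M.endPt p u < M.startPt p v := by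
  constructor
  · intro h u hu v hv
    by_contra hlt
    rw [not_lt] at hlt
    refine h u hu v hv ⟨?_, Set.eq_univ_of_forall fun x => ?_⟩
    · rintro rfl
      exact hlt.not_gt ((M.mem_through_iff p).1 hu)
    · by_cases hx : x = p
      · exact .inl (hx ▸ hu)
      · rw [Set.mem_union, M.mem_arc_of_mem_through hx hu, M.mem_arc_of_mem_through hx hv]
        grind
  · rintro h u hu v hv ⟨-, huv⟩
    have h1 := h u hu u hu
    have h2 := h u hu v hv
    have h3 := h v hv u hu
    have h4 := h v hv v hv
    -- A coordinate that both arcs miss.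
    obtain ⟨m, hm, hm'⟩ := exists_between (max_lt (lt_min h1 h2) (lt_min h3 h4))
    rw [max_lt_iff] at hm
    rw [lt_min_iff] at hm'
    have h0 := pos_nonneg p (M.t u)
    have h5 := pos_lt_one p (M.s u)
    have h6 := M.startPt_cases p u
    have hm0 : 0 < m := lt_of_le_of_lt h0 hm.1
    have hm1 : m < 1 := by grind
    have hpos := pos_add (p := p) hm0.le hm1
    have hx : p + (m : Circ) ≠ p := fun h => by rw [h, pos_self] at hpos; exact hm0.ne hpos
    have : p + (m : Circ) ∈ M.arc u ∪ M.arc v := huv ▸ Set.mem_univ _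
    rw [Set.mem_union, M.mem_arc_of_mem_through hx hu, M.mem_arc_of_mem_through hx hv, hpos] at this
    grind

theorem cwDist_start (p : Circ) (v : V) : cwDist (M.s v) p = 1 - M.startPt p v := by
  rw [cwDist, ← sub_sub_sub_cancel_right p (M.s v) p, coord_sub]
  change (if pos p (M.s v) ≤ pos p p then pos p p - pos p (M.s v)
    else pos p p - pos p (M.s v) + 1) = _
  rw [pos_self]
  have := M.startPt_cases p v
  split_ifs <;> grind

/-- All ends precede all starts, so `[p₁, p₂]` does not wrap, and its interior is the intersection
of the intervals missed by the arcs through `p`. -/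
theorem isSecondPoint_iff [Finite V] {p q : Circ} (hp : M.NoCoverPairAt p) :
    M.IsSecondPoint p q ↔ (M.through p).Nonempty ∧
      ∀ v ∈ M.through p, M.endPt p v < pos p q ∧ pos p q < M.startPt p v := by
  rw [noCoverPairAt_iff] at hp
  unfold IsSecondPoint
  simp only [cwDist_start, sub_le_sub_iff_left]
  change (∃ a ∈ M.through p, ∃ b ∈ M.through p, (∀ c ∈ M.through p, M.endPt p c ≤ M.endPt p a) ∧ _) ↔ _
  have hq1 := pos_lt_one p q
  have key : ∀ a ∈ M.through p, ∀ b ∈ M.through p,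
      (∀ c ∈ M.through p, M.endPt p c ≤ M.endPt p a) →
      (q ∈ Set.cIcc (M.t a) (M.s b) ∧ q ≠ M.t a ∧ q ≠ M.s b ↔
        M.endPt p a < pos p q ∧ pos p q < M.startPt p b) := by
    intro a ha b hb hmax
    have hab := hp a ha b hb
    have h1 := M.startPt_cases p b
    have h2 := hmax b hb
    have h3 := M.pos_ne p b
    have h4 := pos_nonneg p (M.t b)
    have h5 := pos_nonneg p q
    have hne : M.t a ≠ M.s b := by
      intro h
      have h6 : M.endPt p a = pos p (M.s b) := congrArg (pos p) h
      rw [endPt] at h2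
      grind
    have hqa : q ≠ M.t a ↔ pos p q ≠ M.endPt p a := (pos_injective p).ne_iff.symm
    have hqb : q ≠ M.s b ↔ pos p q ≠ pos p (M.s b) := (pos_injective p).ne_iff.symm
    rw [mem_cIcc_iff_pos p hne, hqa, hqb]
    change ((M.endPt p a ≤ pos p q ∧ _) ∨ (_ < M.endPt p a ∧ (M.endPt p a ≤ _ ∨ _))) ∧ _ ↔ _
    rw [endPt] at h2
    grind
  constructor
  · rintro ⟨a, ha, b, hb, hmax, hmin, hq⟩
    have := (key a ha b hb hmax).1 hq
    exact ⟨⟨a, ha⟩, fun v hv => ⟨(hmax v hv).trans_lt this.1, this.2.trans_le (hmin v hv)⟩⟩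
  · rintro ⟨hne, h⟩
    obtain ⟨a, ha, hmax⟩ := (M.through p).toFinite.exists_maximalFor (M.endPt p) _ hne
    obtain ⟨b, hb, hmin⟩ := (M.through p).toFinite.exists_minimalFor (M.startPt p) _ hne
    have hmax' : ∀ c ∈ M.through p, M.endPt p c ≤ M.endPt p a := fun c hc =>
      (le_total _ _).elim (fun h => h) fun h => hmax hc h
    have hmin' : ∀ c ∈ M.through p, M.startPt p b ≤ M.startPt p c := fun c hc =>
      (le_total _ _).elim (fun h => h) fun h => hmin hc h
    exact ⟨a, ha, b, hb, hmax', hmin', (key a ha b hb hmax').2 ⟨(h a ha).1, (h b hb).2⟩⟩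

theorem disjoint_through [Finite V] {p q : Circ} (hp : M.NoCoverPairAt p)
    (hq : M.IsSecondPoint p q) : Disjoint (M.through p) (M.through q) := by
  rw [M.isSecondPoint_iff hp] at hq
  refine Set.disjoint_left.2 fun v hv hv' => ?_
  have h := hq.2 v hv
  have hqp : q ≠ p := by
    rintro rfl
    rw [pos_self] at h
    exact (pos_nonneg q (M.t v)).not_gt h.1
  rcases (M.mem_arc_of_mem_through hqp hv).1 hv' with h' | h'
  · exact h'.not_gt h.2
  · exact h'.not_gt h.1

theorem exists_isSecondPoint [Finite V] {p : Circ} (hp : M.NoCoverPairAt p)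
    (hne : (M.through p).Nonempty) : ∃ q, M.IsSecondPoint p q := by
  simp_rw [M.isSecondPoint_iff hp]
  rw [noCoverPairAt_iff] at hp
  obtain ⟨a, ha, hmax⟩ := (M.through p).toFinite.exists_maximalFor (M.endPt p) _ hne
  obtain ⟨b, hb, hmin⟩ := (M.through p).toFinite.exists_minimalFor (M.startPt p) _ hne
  obtain ⟨m, hm, hm'⟩ := exists_between (hp a ha b hb)
  have hm0 : 0 < m := lt_of_le_of_lt (pos_nonneg p (M.t a)) hm
  have hm1 : m < 1 := by
    have := M.startPt_cases p b
    have := pos_lt_one p (M.s b)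
    grind
  refine ⟨p + (m : Circ), hne, fun v hv => ?_⟩
  rw [pos_add hm0.le hm1]
  exact ⟨((le_total _ _).elim (fun h => h) fun h => hmax hv h).trans_lt hm,
    hm'.trans_le ((le_total _ _).elim (fun h => h) fun h => hmin hv h)⟩

theorem isClique_through (p : Circ) : M.graph.IsClique (M.through p) := fun _ hu _ hv huv =>
  ⟨huv, p, hu, hv⟩

theorem exists_model_compl_through (p : Circ) :
    ∃ I : IntervalModel ↥(M.through p)ᶜ, I.graph = M.graph.induce (M.through p)ᶜ := by
  have h : ∀ v : ↥(M.through p)ᶜ, M.startPt p v < M.endPt p v := fun v =>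
    lt_of_le_of_ne (not_lt.1 fun h => v.2 ((M.mem_through_iff p).2 h)) ((M.isCut p).ne v)
  refine ⟨⟨fun v => M.startPt p v, fun v => M.endPt p v, h⟩, ?_⟩
  ext u v
  have hu := h u
  have hv := h v
  rw [IntervalModel.adj_iff, SimpleGraph.comap_adj, (M.isCut p).adj_iff, ne_eq, ne_eq,
    Subtype.ext_iff]
  simp only [Function.Embedding.subtype_apply]
  grind

theorem compl_through_nonempty (h : ¬ IsIntervalGraph M.graph) (p : Circ) :
    (M.through p)ᶜ.Nonempty := by
  by_contra hne
  rw [Set.not_nonempty_iff_eq_empty, Set.compl_empty_iff] at hne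
  refine h (isIntervalGraph_of_isClique fun u v huv => ?_)
  exact M.isClique_through p (hne ▸ Set.mem_univ u) (hne ▸ Set.mem_univ v) huv

theorem through_nonempty (h : ¬ IsIntervalGraph M.graph) (p : Circ) : (M.through p).Nonempty := by
  by_contra hne
  rw [Set.not_nonempty_iff_eq_empty] at hne
  obtain ⟨I, hI⟩ := M.exists_model_compl_through p
  have hmem : ∀ v, v ∈ (M.through p)ᶜ := fun v => by simp [hne]
  refine h ⟨⟨fun v => I.left ⟨v, hmem v⟩, fun v => I.right ⟨v, hmem v⟩,
    fun v => I.left_lt_right _⟩, ?_⟩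
  ext u v
  have h1 : I.graph.Adj ⟨u, hmem u⟩ ⟨v, hmem v⟩ ↔ M.graph.Adj u v := by rw [hI]; rfl
  rw [← h1, IntervalModel.adj_iff, IntervalModel.adj_iff]
  simp

theorem exists_isMainOutput [Finite V] {p q : Circ} (h : ¬ IsIntervalGraph M.graph) :
    ∃ out, M.IsMainOutput p q out := by
  obtain ⟨L, hL⟩ := exists_isOptimalBoxRep (M.subgraphAt p q)
  obtain ⟨IA, hA⟩ := M.exists_model_compl_through p
  obtain ⟨IB, hB⟩ := M.exists_model_compl_through q
  obtain ⟨IA', hA'⟩ := exists_isExtension (M.compl_through_nonempty h p) IA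
  obtain ⟨IB', hB'⟩ := exists_isExtension (M.compl_through_nonempty h q) IB
  choose f hf using fun I => exists_isExtension ((M.through_nonempty h p).mono
    (Set.subset_union_left (t := M.through q))) I
  refine ⟨_, L, L.map f, IA, IA', IB, IB', hL, ?_, hA, hA', hB, hB', rfl⟩
  rw [List.forall₂_map_right_iff, List.forall₂_same]
  exact fun I _ => hf I

/-- Since `A` and `B` are disjoint, two vertices lie together in `A ∪ B`, outside `A` or outside
`B`. The models of that part decide their adjacency, and no other model separates adjacent vertices.
-/
theorem IsMainOutput.isBoxRep {M : CAModel V} {p q : Circ} {out : List (IntervalModel V)}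
    (hout : M.IsMainOutput p q out) (hd : Disjoint (M.through p) (M.through q)) :
    IsBoxRep out M.graph := by
  obtain ⟨L, L', IA, IA', IB, IB', hL, hLL', hA, hA', hB, hB', rfl⟩ := hout
  intro u v huv
  have hLL : (∀ I ∈ L', I.graph.Adj u v) ↔
      ∀ (hu : u ∈ M.through p ∪ M.through q) (hv : v ∈ M.through p ∪ M.through q),
        M.graph.Adj u v := by
    have h1 : (∀ I ∈ L', I.graph.Adj u v) ↔ ∀ I ∈ L,
        ∀ (hu : u ∈ M.through p ∪ M.through q) (hv : v ∈ M.through p ∪ M.through q),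
        I.graph.Adj ⟨u, hu⟩ ⟨v, hv⟩ := by
      clear hL
      induction hLL' with
      | nil => simp
      | cons h _ ih => rw [List.forall_mem_cons, List.forall_mem_cons, ih, h.adj_iff huv]
    rw [h1]
    constructor
    · intro h hu hv
      have := (hL.1 ⟨u, hu⟩ ⟨v, hv⟩ (by simpa using huv)).2 fun I hI => h I hI hu hv
      exact this
    · intro h I hI hu hv
      exact (hL.1 ⟨u, hu⟩ ⟨v, hv⟩ (by simpa using huv)).1 (h hu hv) I hI
  have hAA : IA'.graph.Adj u v ↔ (u ∉ M.through p → v ∉ M.through p → M.graph.Adj u v) := by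
    rw [hA'.adj_iff huv, hA]; rfl
  have hBB : IB'.graph.Adj u v ↔ (u ∉ M.through q → v ∉ M.through q → M.graph.Adj u v) := by
    rw [hB'.adj_iff huv, hB]; rfl
  simp only [List.mem_append, List.mem_cons, List.not_mem_nil, or_false, or_imp, forall_and,
    forall_eq, hLL, hAA, hBB, Set.mem_union]
  have hu : u ∈ M.through p → u ∉ M.through q := fun h => Set.disjoint_left.1 hd h
  have hv : v ∈ M.through p → v ∉ M.through q := fun h => Set.disjoint_left.1 hd h
  grind

theorem IsMainOutput.length_eq {M : CAModel V} {p q : Circ} {out : List (IntervalModel V)}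
    (hout : M.IsMainOutput p q out) : out.length = boxicity (M.subgraphAt p q) + 2 := by
  obtain ⟨L, L', IA, IA', IB, IB', hL, hLL', hA, hA', hB, hB', rfl⟩ := hout
  simp [← hL.length_eq, hLL'.length_eq]

theorem isBipartite_compl_subgraphAt (p q : Circ) : (M.subgraphAt p q)ᶜ.IsBipartite := by
  classical
  refine ⟨SimpleGraph.Coloring.mk (fun v => if (v : V) ∈ M.through p then 0 else 1) ?_⟩
  intro u v huv
  rw [SimpleGraph.compl_adj] at huv
  have hne : (u : V) ≠ v := fun h => huv.1 (Subtype.ext h)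
  by_cases hu : (u : V) ∈ M.through p <;> by_cases hv : (v : V) ∈ M.through p
  · exact absurd (M.isClique_through p hu hv hne) huv.2
  · simp [hu, hv]
  · simp [hu, hv]
  · exact absurd (M.isClique_through q (u.2.resolve_left hu) (v.2.resolve_left hv) hne) huv.2

theorem isCAGraph_subgraphAt (p q : Circ) : IsCAGraph (M.subgraphAt p q) := by
  refine ⟨⟨fun v => M.s v, fun v => M.t v, fun v => M.s_ne_t v⟩, ?_⟩
  ext u v
  change (u ≠ v ∧ _) ↔ ((u : V) ≠ v ∧ _)
  rw [ne_eq, ne_eq, Subtype.ext_iff]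
  rfl

theorem IsAlgorithmOutput.isBoxRep [Finite V] {M : CAModel V} {p : Circ}
    {out : List (IntervalModel V)} (hp : M.NoCoverPairAt p) (h : M.IsAlgorithmOutput p out) :
    IsBoxRep out M.graph ∧ out.length ≤ boxicity M.graph + 2 := by
  rcases h with ⟨-, I, hI, rfl⟩ | ⟨-, q, hq, hout⟩
  · refine ⟨fun u v _ => by simp [hI], by simp⟩
  · refine ⟨hout.isBoxRep (M.disjoint_through hp hq), ?_⟩
    rw [hout.length_eq]
    exact Nat.add_le_add_right (boxicity_induce_le _ _) 2

theorem exists_isAlgorithmOutput [Finite V] {p : Circ} (hp : M.NoCoverPairAt p) :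
    ∃ out, M.IsAlgorithmOutput p out := by
  by_cases h : IsIntervalGraph M.graph
  · obtain ⟨I, hI⟩ := h
    exact ⟨[I], .inl ⟨⟨I, hI⟩, I, hI, rfl⟩⟩
  · obtain ⟨q, hq⟩ := M.exists_isSecondPoint hp (M.through_nonempty h p)
    obtain ⟨out, hout⟩ := M.exists_isMainOutput (p := p) (q := q) h
    exact ⟨out, .inr ⟨h, q, hq, hout⟩⟩

end CAModel


/-! ### Interval orders -/

/-- The relation `rel` is an interval order on the natural numbers below `n`. -/
structure IsIntervalOrder (n : ℕ) (rel : ℕ → ℕ → Bool) : Prop where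
  irrefl : ∀ v : Fin n, ¬ rel v v
  cross : ∀ a b c d : Fin n, rel a b → rel c d → rel a d ∨ rel c b

/-- The left end points in the interval model of an interval order. -/
def orderLeft (n : ℕ) (rel : ℕ → ℕ → Bool) (v : ℕ) : ℕ :=
  2 * ((List.range n).filter fun w => rel w v).length + 1

/-- The right end points in the interval model of an interval order. -/
def orderRight (n : ℕ) (rel : ℕ → ℕ → Bool) (v : ℕ) : ℕ :=
  2 * ((List.range n).filter fun w => (List.range n).all fun x => !rel v x || rel w x).length

theorem length_filter_range (n : ℕ) (p : ℕ → Bool) :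
    ((List.range n).filter p).length = ((Finset.range n).filter fun v => p v).card := by
  simp [Finset.card, Finset.filter, Finset.range, Multiset.range]

/-- The right end of `u` counts the `w` whose successors include those of `u`. If `rel u v`, all of
these precede `v`. If not, `cross` shows that every predecessor of `v` is counted, and `u` itself is
counted in addition. -/
theorem IsIntervalOrder.right_lt_left_iff {n : ℕ} {rel : ℕ → ℕ → Bool} (h : IsIntervalOrder n rel)
    (u v : Fin n) : orderRight n rel u < orderLeft n rel v ↔ rel u v := by
  unfold orderLeft orderRight
  rw [length_filter_range, length_filter_range]
  constructor
  · intro hlt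
    by_contra huv
    suffices h : ((Finset.range n).filter fun w => rel w v).card <
        ((Finset.range n).filter fun w =>
          ((List.range n).all fun x => !rel u x || rel w x) = true).card by omega
    refine Finset.card_lt_card ⟨?_, fun hsub => ?_⟩
    · intro w hw
      rw [Finset.mem_filter, Finset.mem_range] at hw ⊢
      refine ⟨hw.1, ?_⟩
      rw [List.all_eq_true]
      intro x hx
      rw [List.mem_range] at hx
      have := h.cross u ⟨x, hx⟩ ⟨w, hw.1⟩ v
      simp only [Bool.or_eq_true, Bool.not_eq_true'] at *
      grind
    · have hu : (u : ℕ) ∈ (Finset.range n).filter fun w =>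
          ((List.range n).all fun x => !rel u x || rel w x) = true := by
        simp
      have := hsub hu
      rw [Finset.mem_filter] at this
      exact huv this.2
  · intro huv
    suffices h : ((Finset.range n).filter fun w =>
          ((List.range n).all fun x => !rel u x || rel w x) = true).card ≤
        ((Finset.range n).filter fun w => rel w v).card by omega
    refine Finset.card_le_card fun w hw => ?_
    rw [Finset.mem_filter, List.all_eq_true] at hw
    rw [Finset.mem_filter]
    refine ⟨hw.1, ?_⟩
    have := hw.2 v (List.mem_range.2 v.2)
    simpa [huv] using this

/-- Irreflexivity gives `≤`; left ends are odd and right ends even. -/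
theorem IsIntervalOrder.left_lt_right {n : ℕ} {rel : ℕ → ℕ → Bool} (h : IsIntervalOrder n rel)
    (v : Fin n) : orderLeft n rel v < orderRight n rel v := by
  have h1 : orderLeft n rel v ≤ orderRight n rel v :=
    not_lt.1 fun h' => h.irrefl v ((h.right_lt_left_iff v v).1 h')
  refine h1.lt_of_ne ?_
  unfold orderLeft orderRight
  omega

/-- The interval model of an interval order. -/
noncomputable def IsIntervalOrder.model {n : ℕ} {rel : ℕ → ℕ → Bool} (h : IsIntervalOrder n rel) :
    IntervalModel (Fin n) where
  left v := orderLeft n rel v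
  right v := orderRight n rel v
  left_lt_right v := by exact_mod_cast h.left_lt_right v

theorem IsIntervalOrder.hasCode_model {n : ℕ} {rel : ℕ → ℕ → Bool} (h : IsIntervalOrder n rel) :
    h.model.HasCode (Enc.enc (orderModel n rel)) := by
  refine ⟨fun v => orderLeft n rel v, fun v => orderRight n rel v, fun v => ⟨rfl, rfl⟩, ?_⟩
  have h : orderModel n rel = (List.range n).map fun v => (orderLeft n rel v, orderRight n rel v) :=
    rfl
  rw [h, ← List.map_coe_finRange_eq_range, List.ofFn_eq_map]
  change Data.ofList (List.map _ (List.map _ _)) = _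
  rw [List.map_map, List.map_map]
  rfl

theorem IsIntervalOrder.model_adj_iff {n : ℕ} {rel : ℕ → ℕ → Bool} (h : IsIntervalOrder n rel)
    (u v : Fin n) : h.model.graph.Adj u v ↔ u ≠ v ∧ ¬ rel u v ∧ ¬ rel v u := by
  rw [IntervalModel.adj_iff, ← h.right_lt_left_iff, ← h.right_lt_left_iff, not_lt, not_lt]
  change _ ∧ ((orderLeft n rel u : ℕ) : ℝ) ≤ ((orderRight n rel v : ℕ) : ℝ) ∧
    ((orderLeft n rel v : ℕ) : ℝ) ≤ ((orderRight n rel u : ℕ) : ℝ) ↔ _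
  rw [Nat.cast_le, Nat.cast_le]
  tauto

/-- The restriction of an interval model. -/
def IntervalModel.restrict {V : Type*} (I : IntervalModel V) (S : Set V) : IntervalModel S :=
  ⟨fun v => I.left v, fun v => I.right v, fun v => I.left_lt_right v⟩

theorem IntervalModel.restrict_adj_iff {V : Type*} (I : IntervalModel V) (S : Set V) (u v : S) :
    (I.restrict S).graph.Adj u v ↔ I.graph.Adj u v := by
  rw [IntervalModel.adj_iff, IntervalModel.adj_iff, ne_eq, ne_eq, Subtype.ext_iff]
  rfl

theorem orderLeft_eq_one {n : ℕ} {rel : ℕ → ℕ → Bool} {v : ℕ} (h : ∀ w : Fin n, ¬ rel w v) :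
    orderLeft n rel v = 1 := by
  unfold orderLeft
  rw [List.filter_eq_nil_iff.2 fun w hw => h ⟨w, List.mem_range.1 hw⟩]
  rfl

theorem orderRight_eq {n : ℕ} {rel : ℕ → ℕ → Bool} {v : ℕ} (h : ∀ w : Fin n, ¬ rel v w) :
    orderRight n rel v = 2 * n := by
  unfold orderRight
  rw [List.filter_eq_self.2, List.length_range]
  intro w _
  rw [List.all_eq_true]
  intro x hx
  have := h ⟨x, List.mem_range.1 hx⟩
  simp at this
  simp [this]

/-- Vertices outside `S` are incomparable to all and get `[1, 2n]`. These extremes are attained on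
`S`: a predecessor of the vertex of `S` with least left end would lie in `S` and start earlier, and
dually on the right. -/
theorem IsIntervalOrder.isExtension {n : ℕ} {rel : ℕ → ℕ → Bool} (h : IsIntervalOrder n rel)
    {S : Set (Fin n)} (hS : S.Nonempty) (hrel : ∀ u v : Fin n, rel u v → u ∈ S ∧ v ∈ S) :
    IsExtension (h.model.restrict S) h.model := by
  have : Nonempty S := hS.to_subtype
  obtain ⟨a, ha⟩ := Finite.exists_min (h.model.restrict S).left
  obtain ⟨b, hb⟩ := Finite.exists_max (h.model.restrict S).right
  have ha1 : orderLeft n rel a = 1 := orderLeft_eq_one fun w hw => by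
    have h1 := (h.right_lt_left_iff w a).2 hw
    have h2 := h.left_lt_right w
    have h3 : orderLeft n rel a ≤ orderLeft n rel w := by
      have := ha ⟨w, (hrel _ _ hw).1⟩
      exact (Nat.cast_le (α := ℝ)).1 this
    omega
  have hb1 : orderRight n rel b = 2 * n := orderRight_eq fun w hw => by
    have h1 := (h.right_lt_left_iff b w).2 hw
    have h2 := h.left_lt_right w
    have h3 : orderRight n rel w ≤ orderRight n rel b := by
      have := hb ⟨w, (hrel _ _ hw).2⟩
      exact (Nat.cast_le (α := ℝ)).1 this
    omega
  refine ⟨_, _, ⟨⟨a, rfl⟩, ?_⟩, ⟨⟨b, rfl⟩, ?_⟩, fun v => ⟨rfl, rfl⟩, fun v hv => ⟨?_, ?_⟩⟩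
  · rintro _ ⟨v, rfl⟩; exact ha v
  · rintro _ ⟨v, rfl⟩; exact hb v
  · change ((_ : ℕ) : ℝ) = ((_ : ℕ) : ℝ)
    rw [ha1, orderLeft_eq_one fun w hw => hv (hrel _ _ hw).2]
  · change ((_ : ℕ) : ℝ) = ((_ : ℕ) : ℝ)
    rw [hb1, orderRight_eq fun w hw => hv (hrel _ _ hw).1]

/-! ### Recognition of interval graphs -/

section
variable {V : Type*} {N P : V → V → Prop}

/-- `P` orients the complement of the reflexive and symmetric relation `N`, and agrees with the
forcing relation. -/
structure IsForcedOrientation (N P : V → V → Prop) : Prop where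
  symm : ∀ u v, N u v → N v u
  asymm : ∀ u v, P u v → ¬ P v u
  not_near : ∀ u v, P u v → ¬ N u v
  total : ∀ u v, ¬ N u v → P u v ∨ P v u
  closed : ∀ u v u' v', P u v → N u u' → N v v' → ¬ N u' v' → P u' v'

/-- Forcing moves one side of a directed triangle while keeping the opposite vertex `a`. If `a` were
near `b'`, then `P c a` would force `P c' b'`, against `P b' c'`; likewise for `c'`. -/
theorem IsForcedOrientation.triangle (h : IsForcedOrientation N P) {a b c b' c' : V}
    (hab : P a b) (hbc : P b c) (hca : P c a) (hb : N b b') (hc : N c c') (hbc' : ¬ N b' c')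
    (hrefl : ∀ v, N v v) : P b' c' ∧ P a b' ∧ P c' a := by
  have h1 : P b' c' := h.closed _ _ _ _ hbc hb hc hbc'
  have h2 : ¬ N a b' := fun hab' => by
    have := h.closed _ _ _ _ hca hc hab' (fun h' => hbc' (h.symm _ _ h'))
    exact h.asymm _ _ h1 this
  have h3 : ¬ N c' a := fun hac' => by
    have := h.closed _ _ _ _ hab (h.symm _ _ hac') hb (fun h' => hbc' (h.symm _ _ h'))
    exact h.asymm _ _ h1 this
  exact ⟨h1, h.closed _ _ _ _ hab (hrefl a) hb h2, h.closed _ _ _ _ hca hc (hrefl a) h3⟩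

/-- Without directed triangles `P` is transitive. If `a`, `d` and `c`, `b` are both near, `P a b`
forces `P d c`. Otherwise a missing comparison is oriented the other way, and transitivity along the
resulting path gives a contradiction. -/
theorem IsForcedOrientation.cross (h : IsForcedOrientation N P) (hrefl : ∀ v, N v v)
    (hacyc : ∀ a b c, P a b → P b c → ¬ P c a) {a b c d : V} (hab : P a b) (hcd : P c d) :
    P a d ∨ P c b := by
  by_contra! hne
  have h1 : ∀ {x y z}, P x y → P y z → ¬ N x z := by
    intro x y z hxy hyz hxz
    have := h.closed x y z y hxy hxz (hrefl y) (fun h' => h.not_near _ _ hyz (h.symm _ _ h'))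
    exact h.asymm _ _ hyz this
  have h2 : ∀ {x y z}, P x y → P y z → P x z := fun hxy hyz =>
    (h.total _ _ (h1 hxy hyz)).resolve_right (hacyc _ _ _ hxy hyz)
  by_cases had : N a d
  · by_cases hcb : N c b
    · have := h.closed _ _ _ _ hab had (h.symm _ _ hcb)
        (fun h' => h.not_near _ _ hcd (h.symm _ _ h'))
      exact h.asymm _ _ hcd this
    · have hbc := (h.total _ _ hcb).resolve_left hne.2
      exact h.not_near _ _ (h2 hab (h2 hbc hcd)) had
  · have hda := (h.total _ _ had).resolve_left hne.1
    exact hne.2 (h2 hcd (h2 hda hab))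

end

/-! ### Forcing classes and their labels -/

section
variable {n : ℕ} {L : List (ℕ × ℕ)}

theorem near_symm (L : List (ℕ × ℕ)) {u v : ℕ} (h : near L u v = true) : near L v u = true := by
  unfold near at *
  rw [twoOf_iff] at *
  tauto

/-- The index of an ordered pair. -/
def pairIndex (e : Fin n × Fin n) : ℕ := e.1 * n + e.2

theorem pairIndex_lt (e : Fin n × Fin n) : pairIndex e < n * n := by
  have h1 := e.1.2
  have h2 := e.2.2
  unfold pairIndex
  nlinarith

theorem pairIndex_injective : Function.Injective (pairIndex (n := n)) := by
  rintro ⟨a, b⟩ ⟨c, d⟩ h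
  simp only [pairIndex] at h
  have hn : 0 < n := a.pos
  have h1 := congrArg (· / n) h
  have h2 := congrArg (· % n) h
  simp only [mul_comm _ n, Nat.mul_add_div hn, Nat.mul_add_mod, Nat.div_eq_of_lt b.2,
    Nat.div_eq_of_lt d.2, Nat.mod_eq_of_lt b.2, Nat.mod_eq_of_lt d.2, add_zero] at h1 h2
  exact Prod.ext (Fin.ext h1) (Fin.ext h2)

/-- The forcing relation. -/
def Forced (L : List (ℕ × ℕ)) (e f : Fin n × Fin n) : Prop :=
  forced L (e.1, e.2) (f.1, f.2) = true

theorem forced_iff {e f : Fin n × Fin n} : Forced L e f ↔ ¬ near L e.1 e.2 ∧ ¬ near L f.1 f.2 ∧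
    near L e.1 f.1 ∧ near L e.2 f.2 := by
  simp [Forced, forced, and_assoc]

theorem Forced.symm {e f : Fin n × Fin n} (h : Forced L e f) : Forced L f e := by
  rw [forced_iff] at *
  exact ⟨h.2.1, h.1, near_symm L h.2.2.1, near_symm L h.2.2.2⟩

theorem Forced.swap {e f : Fin n × Fin n} (h : Forced L e f) : Forced L e.swap f.swap := by
  rw [forced_iff] at *
  exact ⟨fun h' => h.1 (near_symm L h'), fun h' => h.2.1 (near_symm L h'), h.2.2.2, h.2.2.1⟩

/-- The label of an ordered pair. -/
def label (c : List ℕ) (e : Fin n × Fin n) : ℕ := labelAt n c e.1 e.2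

theorem label_mergeLabels {d : List ℕ} (hc : d.length = n * n) (x y : ℕ) (e : Fin n × Fin n) :
    label (mergeLabels d x y) e =
      if label d e = x ∨ label d e = y then min x y else label d e := by
  have h : pairIndex e < d.length := hc ▸ pairIndex_lt e
  have h' : label d e = d[pairIndex e] := List.getD_eq_getElem _ _ h
  have h'' : pairIndex e < (mergeLabels d x y).length := by simpa [mergeLabels] using h
  have h3 : label (mergeLabels d x y) e = (mergeLabels d x y)[pairIndex e] :=
    List.getD_eq_getElem _ _ h''
  rw [h3, h']
  simp only [mergeLabels, List.getElem_map]
  by_cases h1 : d[pairIndex e] = x ∨ d[pairIndex e] = y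
  · have h2 : (d[pairIndex e] == x || d[pairIndex e] == y) = true := by simpa using h1
    rw [if_pos h1, h2, cond_true]
    rcases lt_or_ge x y with hxy | hxy
    · simp [hxy, hxy.le]
    · simp [hxy, hxy.not_gt]
  · have h2 : (d[pairIndex e] == x || d[pairIndex e] == y) = false := by simpa using h1
    rw [if_neg h1, h2, cond_false]

/-- The labels are the indices of smaller pairs in the same class of the forcing relation. -/
def LabelsSound (L : List (ℕ × ℕ)) (n : ℕ) (c : List ℕ) : Prop :=
  c.length = n * n ∧ ∀ e : Fin n × Fin n, ∃ f : Fin n × Fin n,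
    Relation.EqvGen (Forced L) e f ∧ label c e = pairIndex f ∧ pairIndex f ≤ pairIndex e

theorem LabelsSound.mergeLabels {c : List ℕ} (h : LabelsSound L n c) {e₁ e₂ : Fin n × Fin n}
    (h12 : Forced L e₁ e₂) : LabelsSound L n (mergeLabels c (label c e₁) (label c e₂)) := by
  refine ⟨by simpa [BoxApprox.mergeLabels] using h.1, fun e => ?_⟩
  obtain ⟨f, hf, hf', hf''⟩ := h.2 e
  obtain ⟨f₁, hf₁, hf₁', -⟩ := h.2 e₁
  obtain ⟨f₂, hf₂, hf₂', -⟩ := h.2 e₂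
  have h12' : Relation.EqvGen (Forced L) f₁ f₂ :=
    (hf₁.symm.trans _ _ _ (.rel _ _ h12)).trans _ _ _ hf₂
  rw [label_mergeLabels h.1]
  split_ifs with hc
  · rw [hf', hf₁', hf₂', pairIndex_injective.eq_iff, pairIndex_injective.eq_iff] at hc
    have h1 : Relation.EqvGen (Forced L) e f₁ ∧ Relation.EqvGen (Forced L) e f₂ := by
      rcases hc with rfl | rfl
      · exact ⟨hf, hf.trans _ _ _ h12'⟩
      · exact ⟨hf.trans _ _ _ h12'.symm, hf⟩
    have h2 : min (pairIndex f₁) (pairIndex f₂) ≤ pairIndex f := by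
      rcases hc with rfl | rfl
      · exact min_le_left _ _
      · exact min_le_right _ _
    rw [hf₁', hf₂']
    rcases min_choice (pairIndex f₁) (pairIndex f₂) with h3 | h3
    · exact ⟨f₁, h1.1, h3, by omega⟩
    · exact ⟨f₂, h1.2, h3, by omega⟩
  · exact ⟨f, hf, hf', hf''⟩

theorem labels_fold (hn : L.length = n) (qs : List ((ℕ × ℕ) × (ℕ × ℕ)))
    (hqs : ∀ q ∈ qs, q.1 ∈ vertexPairs L ∧ q.2 ∈ vertexPairs L) :
    LabelsSound L n (qs.foldl (labelStep L) (List.range (n * n))) ∧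
      ∀ e f : Fin n × Fin n, (((e.1 : ℕ), (e.2 : ℕ)), ((f.1 : ℕ), (f.2 : ℕ))) ∈ qs → Forced L e f →
        label (qs.foldl (labelStep L) (List.range (n * n))) e =
          label (qs.foldl (labelStep L) (List.range (n * n))) f := by
  induction qs using List.reverseRecOn with
  | nil =>
    refine ⟨⟨by simp, fun e => ⟨e, .refl _, ?_, le_rfl⟩⟩, fun e f h => by simp at h⟩
    have h := pairIndex_lt e
    have : label (List.range (n * n)) e = (List.range (n * n))[pairIndex e]'(by simpa using h) :=
      List.getD_eq_getElem _ _ _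
    simpa using this
  | append_singleton qs q ih =>
    obtain ⟨ih1, ih2⟩ := ih fun q hq => hqs q (List.mem_append_left _ hq)
    rw [List.foldl_append, List.foldl_cons, List.foldl_nil]
    set c := qs.foldl (labelStep L) (List.range (n * n))
    obtain ⟨⟨u, v⟩, ⟨u', v'⟩⟩ := q
    have hq := hqs ((u, v), (u', v')) (by simp)
    simp only [vertexPairs, mem_pairs, List.mem_range, hn] at hq
    by_cases hfor : forced L (u, v) (u', v') = true
    · have hstep : labelStep L c ((u, v), (u', v')) =
          mergeLabels c (label c (⟨u, hq.1.1⟩, ⟨v, hq.1.2⟩)) (label c (⟨u', hq.2.1⟩, ⟨v', hq.2.2⟩)) := by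
        simp [labelStep, hfor, label, hn]
      rw [hstep]
      refine ⟨ih1.mergeLabels (e₁ := (⟨u, hq.1.1⟩, ⟨v, hq.1.2⟩)) (e₂ := (⟨u', hq.2.1⟩, ⟨v', hq.2.2⟩))
        hfor, fun e f hef hef' => ?_⟩
      rw [label_mergeLabels ih1.1, label_mergeLabels ih1.1]
      rcases List.mem_append.1 hef with h | h
      · rw [ih2 e f h hef']
      · rw [List.mem_singleton] at h
        simp only [Prod.mk.injEq] at h
        have he : e = (⟨u, hq.1.1⟩, ⟨v, hq.1.2⟩) :=
          Prod.ext (Fin.ext h.1.1) (Fin.ext h.1.2)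
        have hf : f = (⟨u', hq.2.1⟩, ⟨v', hq.2.2⟩) :=
          Prod.ext (Fin.ext h.2.1) (Fin.ext h.2.2)
        rw [← he, ← hf, if_pos (.inl rfl), if_pos (.inr rfl)]
    · have hstep : labelStep L c ((u, v), (u', v')) = c := by
        simp [labelStep, hfor]
      rw [hstep]
      refine ⟨ih1, fun e f hef hef' => ?_⟩
      rcases List.mem_append.1 hef with h | h
      · exact ih2 e f h hef'
      · rw [List.mem_singleton] at h
        simp only [Prod.mk.injEq] at h
        rw [Forced, h.1.1, h.1.2, h.2.1, h.2.2] at hef'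
        exact absurd hef' hfor

/-- Together the two properties say that the label of a pair is the least index in its class. -/
theorem labels_sound (hn : L.length = n) : LabelsSound L n (labels L) ∧
    ∀ e f : Fin n × Fin n, Forced L e f → label (labels L) e = label (labels L) f := by
  obtain ⟨h1, h2⟩ := labels_fold hn (pairs (vertexPairs L) (vertexPairs L))
    fun q hq => mem_pairs.1 hq
  unfold labels
  rw [hn]
  refine ⟨h1, fun e f hef => h2 e f ?_ hef⟩
  simp [vertexPairs, mem_pairs, hn]

theorem label_labels (hn : L.length = n) (e : Fin n × Fin n) :
    label (labels L) e = classOf L e.1 e.2 := by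
  rw [classOf, hn]; rfl

theorem conflict_iff (hn : L.length = n) : conflict L = true ↔
    ∃ u v : Fin n, ¬ near L u v ∧ classOf L u v = classOf L v u := by
  simp only [conflict, List.any_eq_true, List.mem_range, hn, Bool.and_eq_true, beq_iff_eq,
    Bool.not_eq_true', Bool.not_eq_true]
  constructor
  · rintro ⟨u, hu, v, hv, h⟩
    exact ⟨⟨u, hu⟩, ⟨v, hv⟩, h⟩
  · rintro ⟨u, v, h⟩
    exact ⟨u, u.2, v, v.2, h⟩

/-- In an interval model, "entirely to the left of" is invariant under forcing. A class with a pair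
and its reversal would put each of the two disjoint intervals left of the other. -/
theorem not_isIntervalGraph_of_conflict (hn : L.length = n) {G : SimpleGraph (Fin n)}
    (hG : ∀ u v : Fin n, near L u v ↔ u = v ∨ G.Adj u v) (h : conflict L = true) :
    ¬ IsIntervalGraph G := by
  rintro ⟨I, rfl⟩
  obtain ⟨u, v, huv, hc⟩ := (conflict_iff hn).1 h
  have hnear : ∀ u v : Fin n, near L u v ↔ I.left u ≤ I.right v ∧ I.left v ≤ I.right u := by
    intro u v
    rw [hG, IntervalModel.adj_iff]
    by_cases h : u = v
    · subst h; simpa using (I.left_lt_right u).le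
    · simp [h]
  obtain ⟨⟨-, hs⟩, -⟩ := labels_sound hn
  have hconn : Relation.EqvGen (Forced L) (u, v) (v, u) := by
    obtain ⟨f, hf, hf', -⟩ := hs (u, v)
    obtain ⟨g, hg, hg', -⟩ := hs (v, u)
    have : f = g := pairIndex_injective (by
      rw [← hf', ← hg', label_labels hn, label_labels hn]; exact hc)
    subst this
    exact hf.trans _ _ _ hg.symm
  have hinv : ∀ e f : Fin n × Fin n, Relation.EqvGen (Forced L) e f →
      (I.right e.1 < I.left e.2 ↔ I.right f.1 < I.left f.2) := by
    intro e f hef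
    induction hef with
    | rel e f h =>
      rw [forced_iff] at h
      simp only [hnear] at h
      have h1 := I.left_lt_right e.1
      have h2 := I.left_lt_right e.2
      have h3 := I.left_lt_right f.1
      have h4 := I.left_lt_right f.2
      grind
    | refl => rfl
    | symm _ _ _ ih => exact ih.symm
    | trans _ _ _ _ _ ih1 ih2 => exact ih1.trans ih2
  have h1 := hinv _ _ hconn
  rw [hnear] at huv
  have h2 := I.left_lt_right u
  have h3 := I.left_lt_right v
  grind

/-- Reversal maps forcing classes to forcing classes, so comparing the two labels orients a whole
class alike; absence of conflict means there are no ties. -/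
theorem isForcedOrientation_lexRel (hn : L.length = n) (h : conflict L = false) :
    IsForcedOrientation (fun u v : Fin n => near L u v = true)
      (fun u v : Fin n => lexRel L u v = true) where
  symm u v := near_symm L
  asymm u v h := by
    simp only [lexRel, Bool.and_eq_true, decide_eq_true_eq] at *
    omega
  not_near u v h := by
    simp only [lexRel, Bool.and_eq_true, Bool.not_eq_true'] at *
    simp [h.1]
  total u v huv := by
    have hc : classOf L u v ≠ classOf L v u := fun hc => by
      rw [(conflict_iff hn).2 ⟨u, v, huv, hc⟩] at h
      exact absurd h (by simp)
    have hvu : ¬ near L v u = true := fun h' => huv (near_symm L h')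
    rw [Bool.not_eq_true] at huv hvu
    simp only [lexRel, Bool.and_eq_true, decide_eq_true_eq, huv, hvu, Bool.not_false, true_and]
    omega
  closed u v u' v' h hu hv huv' := by
    simp only [lexRel, Bool.and_eq_true, decide_eq_true_eq, Bool.not_eq_true'] at *
    have hf : Forced L (u, v) (u', v') :=
      forced_iff.2 ⟨by simp [h.1], huv', hu, hv⟩
    have h1 := (labels_sound hn).2 _ _ hf
    have h2 := (labels_sound hn).2 _ _ hf.swap
    simp only [label_labels hn, Prod.swap] at h1 h2
    refine ⟨by simpa using huv', ?_⟩
    omega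

theorem lexRel_acyclic (hn : L.length = n) (h : conflict L = false)
    (hrefl : ∀ v : Fin n, near L v v = true) (a b c : Fin n) (hab : lexRel L a b = true)
    (hbc : lexRel L b c = true) : ¬ lexRel L c a = true := by
  have hor := isForcedOrientation_lexRel hn h
  intro hca
  let T : Fin n → Prop := fun a => ∃ b c : Fin n,
    lexRel L a b = true ∧ lexRel L b c = true ∧ lexRel L c a = true
  have hT : ∃ a, T a := ⟨a, b, c, hab, hbc, hca⟩
  -- Among all directed triangles take one whose vertex `a` is smallest. By the triangle lemma every
  -- pair in the class of `(c, a)` forms a directed triangle with `b`.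
  obtain ⟨a, ⟨b, c, hab, hbc, hca⟩, hmin⟩ := WellFounded.has_min (wellFounded_lt (α := Fin n))
    {a | T a} hT
  have hcls : ∀ e f : Fin n × Fin n, Relation.EqvGen (Forced L) e f →
      ((lexRel L e.1 e.2 = true ∧ lexRel L b e.1 = true ∧ lexRel L e.2 b = true) ↔
        (lexRel L f.1 f.2 = true ∧ lexRel L b f.1 = true ∧ lexRel L f.2 b = true)) := by
    have key : ∀ e f : Fin n × Fin n, Forced L e f →
      ((lexRel L e.1 e.2 = true ∧ lexRel L b e.1 = true ∧ lexRel L e.2 b = true) →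
        (lexRel L f.1 f.2 = true ∧ lexRel L b f.1 = true ∧ lexRel L f.2 b = true)) := by
      intro e f hef he
      have h' := forced_iff.1 hef
      exact hor.triangle he.2.1 he.1 he.2.2 h'.2.2.1 h'.2.2.2 h'.2.1 hrefl
    intro e f hef
    induction hef with
    | rel e f h => exact ⟨key e f h, key f e h.symm⟩
    | refl => rfl
    | symm _ _ _ ih => exact ih.symm
    | trans _ _ _ _ _ ih1 ih2 => exact ih1.trans ih2
  obtain ⟨⟨x, y⟩, hf, hf', -⟩ := (labels_sound hn).1.2 (c, a)
  obtain ⟨g, -, hg, hg'⟩ := (labels_sound hn).1.2 (a, c)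
  have h1 := (hcls _ _ hf).1 ⟨hca, hbc, hab⟩
  -- The pair `(x, y)` represents the class of `(c, a)`, whose label is below that of `(a, c)`.
  -- Hence `x ≤ a`, and minimality gives `x = a`; then `b` precedes `a`, contradicting `hab`.
  have hlt : pairIndex (x, y) < pairIndex (a, c) := by
    refine lt_of_lt_of_le ?_ hg'
    rw [← hf', ← hg, label_labels hn, label_labels hn]
    have := hca
    simp only [lexRel, Bool.and_eq_true, decide_eq_true_eq] at this
    exact this.2
  have hax : a ≤ x := not_lt.1 (hmin x ⟨y, b, h1.1, h1.2.2, h1.2.1⟩)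
  have hxa : (x : ℕ) ≤ a := by
    by_contra hne
    have h2 : ((a : ℕ) + 1) * n ≤ x * n := Nat.mul_le_mul_right _ (by omega)
    have h3 := c.2
    simp only [pairIndex] at hlt
    rw [Nat.succ_mul] at h2
    omega
  have : x = a := le_antisymm hxa hax
  subst this
  exact hor.asymm _ _ hab h1.2.1

theorem isIntervalOrder_lexRel (hn : L.length = n) (h : conflict L = false)
    (hrefl : ∀ v : Fin n, near L v v = true) : IsIntervalOrder n (lexRel L) where
  irrefl v hv := (isForcedOrientation_lexRel hn h).not_near v v hv (hrefl v)
  cross _ _ _ _ := (isForcedOrientation_lexRel hn h).cross hrefl (lexRel_acyclic hn h hrefl)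

theorem graph_lexRel (hn : L.length = n) {G : SimpleGraph (Fin n)}
    (hG : ∀ u v : Fin n, near L u v ↔ u = v ∨ G.Adj u v) (h : conflict L = false)
    (ho : IsIntervalOrder n (lexRel L)) : ho.model.graph = G := by
  have hor := isForcedOrientation_lexRel hn h
  ext u v
  rw [ho.model_adj_iff]
  have h1 := hor.not_near u v
  have h2 := hor.not_near v u
  have h3 := hor.total u v
  rw [hG] at h1 h2 h3
  have h4 := fun h : G.Adj u v => h.ne
  have h5 := G.adj_comm u v
  grind

end


/-! ### Optimum box representations of the co-bipartite part -/

/-- The gap `j` and the gap `k` describe the disjoint cliques `A` and `B` of the graph `G`. -/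
structure IsGapPair {n : ℕ} (L : List (ℕ × ℕ)) (j k : ℕ) (G : SimpleGraph (Fin n))
    (A B : Set (Fin n)) : Prop where
  length_eq : L.length = n
  near_iff : ∀ u v : Fin n, near L u v ↔ u = v ∨ G.Adj u v
  cut : IsCut G A (fun v : Fin n => startKey L j v) (fun v : Fin n => endKey L j v)
  cut' : IsCut G B (fun v : Fin n => startKey L k v) (fun v : Fin n => endKey L k v)
  disjoint : Disjoint A B

section
variable {n : ℕ} {L : List (ℕ × ℕ)} {j k : ℕ} {G : SimpleGraph (Fin n)} {A B : Set (Fin n)}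

theorem onGap_iff (h : IsCut G A (fun v : Fin n => startKey L j v) (fun v : Fin n => endKey L j v))
    (v : Fin n) : onGap L j v = true ↔ v ∈ A := by
  rw [h.mem_iff, onGap, decide_eq_true_eq]

theorem cutRel_iff (h : IsCut G A (fun v : Fin n => startKey L j v) (fun v : Fin n => endKey L j v))
    (u v : Fin n) : cutRel L j u v = true ↔ u ∉ A ∧ v ∉ A ∧ endKey L j u < startKey L j v := by
  rw [← onGap_iff h, ← onGap_iff h]
  simp [cutRel, and_assoc]

theorem isIntervalOrder_cutRel
    (h : IsCut G A (fun v : Fin n => startKey L j v) (fun v : Fin n => endKey L j v)) :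
    IsIntervalOrder n (cutRel L j) where
  irrefl v hv := by
    rw [cutRel_iff h] at hv
    exact hv.1 ((h.mem_iff v).2 hv.2.2)
  cross a b c d := by
    simp only [cutRel_iff h]
    grind

theorem cutRel_model_graph
    (h : IsCut G A (fun v : Fin n => startKey L j v) (fun v : Fin n => endKey L j v)) :
    ((isIntervalOrder_cutRel h).model.restrict Aᶜ).graph = G.induce Aᶜ := by
  ext u v
  rw [IntervalModel.restrict_adj_iff, IsIntervalOrder.model_adj_iff, cutRel_iff h, cutRel_iff h,
    SimpleGraph.comap_adj, h.adj_iff]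
  simp only [Function.Embedding.subtype_apply, ← h.mem_iff]
  have hu : (u : Fin n) ∉ A := u.2
  have hv : (v : Fin n) ∉ A := v.2
  simp only [hu, hv, not_false_iff, true_and, not_lt, or_false, and_false]
  tauto

theorem IsGapPair.clique_left (h : IsGapPair L j k G A B) : G.IsClique A := fun u hu v hv huv =>
  (h.cut.adj_iff u v).2 ⟨huv, .inr (.inl ⟨(h.cut.mem_iff u).1 hu, (h.cut.mem_iff v).1 hv⟩)⟩

theorem IsGapPair.clique_right (h : IsGapPair L j k G A B) : G.IsClique B := fun u hu v hv huv =>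
  (h.cut'.adj_iff u v).2 ⟨huv, .inr (.inl ⟨(h.cut'.mem_iff u).1 hu, (h.cut'.mem_iff v).1 hv⟩)⟩

theorem IsGapPair.adj_iff (h : IsGapPair L j k G A B) {a b : Fin n} (ha : a ∈ A) (hb : b ∈ B) :
    G.Adj a b ↔ startKey L j a ≤ endKey L j b ∨ startKey L j b ≤ endKey L j a := by
  have hbA : b ∉ A := fun h' => Set.disjoint_left.1 h.disjoint h' hb
  have hne : a ≠ b := fun h' => hbA (h' ▸ ha)
  rw [h.cut.adj_iff]
  simp only [← h.cut.mem_iff, ha, hbA, hne, ne_eq, not_false_iff, true_and, and_false,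
    or_false, and_true, false_or]
  tauto

/-- The arc of `b` is an interval inside the open interval missed by the arc of `a`. The pair is
best seen as a planar box with lower corner (end of `a`, end of `b`) and upper corner (start of `b`,
start of `a`); `below` says that the upper corner of one box is coordinatewise at most the lower
corner of the other. -/
theorem IsGapPair.mem_crossPairs (h : IsGapPair L j k G A B) (a b : Fin n) :
    ((a : ℕ), (b : ℕ)) ∈ crossPairs L j k ↔ a ∈ A ∧ b ∈ B ∧
      endKey L j a < startKey L j b ∧ endKey L j b < startKey L j a := by
  simp only [crossPairs, vertexPairs, List.mem_filter, mem_pairs, List.mem_range, h.length_eq,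
    a.2, b.2, Bool.and_eq_true, onGap_iff h.cut, onGap_iff h.cut', true_and, and_assoc,
    Bool.not_eq_true']
  refine and_congr_right fun ha => and_congr_right fun hb => ?_
  rw [← Bool.not_eq_true, h.near_iff, h.adj_iff ha hb]
  have hne : a ≠ b := fun h' => Set.disjoint_left.1 h.disjoint ha (h' ▸ hb)
  simp only [hne, false_or, not_or, not_le]
  tauto

theorem IsGapPair.exists_of_mem_crossPairs (h : IsGapPair L j k G A B) {e : ℕ × ℕ}
    (he : e ∈ crossPairs L j k) : ∃ a b : Fin n, e = ((a : ℕ), (b : ℕ)) := by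
  have := (List.mem_filter.1 he).1
  obtain ⟨a, b⟩ := e
  rw [vertexPairs, mem_pairs, List.mem_range, List.mem_range, h.length_eq] at this
  exact ⟨⟨a, this.1⟩, ⟨b, this.2⟩, rfl⟩

theorem below_iff {e e' : ℕ × ℕ} : below L j e e' = true ↔
    startKey L j e.2 ≤ endKey L j e'.1 ∧ startKey L j e.1 ≤ endKey L j e'.2 := by
  simp [below]

theorem IsGapPair.layerRel_iff (h : IsGapPair L j k G A B) (R : List (ℕ × ℕ)) (a b : Fin n) :
    layerRel L j k R a b = true ↔ ((a : ℕ), (b : ℕ)) ∈ crossPairs L j k ∧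
      (∀ e ∈ R, ¬ (startKey L j e.2 ≤ endKey L j a ∧ startKey L j e.1 ≤ endKey L j b)) ∧
      ∃ e ∈ R, startKey L j e.2 ≤ startKey L j b ∧ startKey L j e.1 ≤ startKey L j a := by
  simp only [crossPairs, vertexPairs, List.mem_filter, mem_pairs, List.mem_range, h.length_eq,
    a.2, b.2, layerRel, Bool.and_eq_true, List.all_eq_true, List.any_eq_true, decide_eq_true_eq,
    Bool.not_eq_true', ← Bool.not_eq_true, below_iff, true_and, and_assoc]

/-- The pairs whose lower corner lies in a down-set and whose upper corner does not form a chain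
graph. -/
theorem chain_of_downset {X Y : Type*} [LinearOrder X] [LinearOrder Y] {D : X → Y → Prop}
    (hD : ∀ x x' y y', x ≤ x' → y ≤ y' → D x' y' → D x y) {x₁ x₁' x₂ x₂' : X} {y₁ y₁' y₂ y₂' : Y}
    (hx₁ : x₁ < x₁') (hy₁ : y₁ < y₁') (hx₂ : x₂ < x₂') (hy₂ : y₂ < y₂')
    (h₁ : D x₁ y₁) (h₁' : ¬ D x₁' y₁') (h₂ : D x₂ y₂) (h₂' : ¬ D x₂' y₂') :
    (x₁ < x₂' ∧ y₂ < y₁' ∧ D x₁ y₂ ∧ ¬ D x₂' y₁') ∨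
      (x₂ < x₁' ∧ y₁ < y₂' ∧ D x₂ y₁ ∧ ¬ D x₁' y₂') := by
  grind

/-- The points that dominate no upper corner of `R` form a down-set. `layerRel` collects the cross
pairs whose lower corner lies in it and whose upper corner does not, so `chain_of_downset` applies.
-/
theorem IsGapPair.isIntervalOrder_layerRel (h : IsGapPair L j k G A B) (R : List (ℕ × ℕ)) :
    IsIntervalOrder n (layerRel L j k R) where
  irrefl v hv := by
    rw [h.layerRel_iff, h.mem_crossPairs] at hv
    exact Set.disjoint_left.1 h.disjoint hv.1.1 hv.1.2.1
  cross a b c d := by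
    simp only [h.layerRel_iff, h.mem_crossPairs]
    rintro ⟨⟨ha, hb, hx₁, hy₁⟩, h₁, e₁, he₁, h₁'⟩ ⟨⟨hc, hd, hx₂, hy₂⟩, h₂, e₂, he₂, h₂'⟩
    have := chain_of_downset (D := fun x y => ∀ e ∈ R, ¬ (startKey L j e.2 ≤ x ∧ startKey L j e.1 ≤ y))
      (fun x x' y y' hx hy hD e he he' => hD e he ⟨he'.1.trans hx, he'.2.trans hy⟩)
      hx₁ hy₁ hx₂ hy₂ h₁ (fun hD => hD e₁ he₁ h₁') h₂ (fun hD => hD e₂ he₂ h₂')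
    push Not at this
    rcases this with ⟨h3, h4, h5, h6⟩ | ⟨h3, h4, h5, h6⟩
    · left
      exact ⟨⟨ha, hd, h3, h4⟩, fun e he he' => (h5 e he he'.1).not_ge he'.2, h6⟩
    · right
      exact ⟨⟨hc, hb, h3, h4⟩, fun e he he' => (h5 e he he'.1).not_ge he'.2, h6⟩

/-! ### Peeling the order of nonadjacent pairs: layers and chains -/

theorem mem_peel {R : List (ℕ × ℕ)} {e : ℕ × ℕ} :
    e ∈ peel L j R ↔ e ∈ R ∧ ∃ e' ∈ R, below L j e' e = true := by
  simp [peel]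

theorem layer_succ (L : List (ℕ × ℕ)) (j k i : ℕ) :
    layer L j k (i + 1) = peel L j (layer L j k i) := by
  rw [layer, Function.iterate_succ_apply']; rfl

theorem layer_subset_crossPairs {i : ℕ} {e : ℕ × ℕ} (he : e ∈ layer L j k i) :
    e ∈ crossPairs L j k := by
  induction i with
  | zero => exact he
  | succ i ih => rw [layer_succ] at he; exact ih (mem_peel.1 he).1

/-- A pair with the earliest start of its second vertex is minimal: a pair below it would have an
even earlier one. -/
theorem IsGapPair.length_peel_lt (h : IsGapPair L j k G A B) {R : List (ℕ × ℕ)}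
    (hR : ∀ e ∈ R, e ∈ crossPairs L j k) (hne : R ≠ []) : (peel L j R).length < R.length := by
  obtain ⟨e, he, hmin⟩ := R.toFinset.exists_min_image (fun e => startKey L j e.2)
    (by simpa using hne)
  rw [List.mem_toFinset] at he
  refine List.length_filter_lt_length_iff_exists.2 ⟨e, he, fun h' => ?_⟩
  obtain ⟨e', he', hb⟩ := List.any_eq_true.1 h'
  have h1 := hmin e' (List.mem_toFinset.2 he')
  obtain ⟨a, b, rfl⟩ := h.exists_of_mem_crossPairs (hR e he)
  have h2 := (h.mem_crossPairs a b).1 (hR _ he)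
  rw [below_iff] at hb
  have := hb.1
  simp only at *
  omega

theorem IsGapPair.length_layer (h : IsGapPair L j k G A B) (i : ℕ) :
    layer L j k i = [] ∨ (layer L j k i).length + i ≤ (crossPairs L j k).length := by
  induction i with
  | zero => right; exact le_rfl
  | succ i ih =>
    by_cases hne : layer L j k i = []
    · left
      rw [layer_succ, hne]; rfl
    · right
      have h1 := ih.resolve_left hne
      have h2 := h.length_peel_lt (fun e he => layer_subset_crossPairs he) hne
      rw [← layer_succ] at h2
      omega

theorem length_vertexPairs (L : List (ℕ × ℕ)) : (vertexPairs L).length = L.length * L.length := by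
  simp [vertexPairs, pairs, List.length_flatten, Function.comp_def]

/-- Every cross pair is minimal in one of the layers. -/
theorem IsGapPair.exists_layer (h : IsGapPair L j k G A B) {e : ℕ × ℕ}
    (he : e ∈ crossPairs L j k) :
    ∃ R ∈ layers L j k, e ∈ R ∧ ∀ e' ∈ R, ¬ below L j e' e = true := by
  have hex : ∃ i, e ∉ layer L j k i := by
    refine ⟨(crossPairs L j k).length + 1, fun h' => ?_⟩
    rcases h.length_layer ((crossPairs L j k).length + 1) with h1 | h1
    · rw [h1] at h'; simp at h'
    · omega
  classical
  have hpos : Nat.find hex ≠ 0 := fun h0 => by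
    have := Nat.find_spec hex
    rw [h0] at this
    exact this he
  obtain ⟨i, hi⟩ := Nat.exists_eq_succ_of_ne_zero hpos
  have hmem : e ∈ layer L j k i := by
    by_contra h'
    have := Nat.find_min' hex h'
    omega
  have hnot : e ∉ layer L j k (i + 1) := by
    have := Nat.find_spec hex
    rwa [hi] at this
  refine ⟨layer L j k i, ?_, hmem, fun e' he' hb => hnot ?_⟩
  · simp only [layers, List.mem_filter, List.mem_map, List.mem_range]
    refine ⟨⟨i, ?_, rfl⟩, ?_⟩
    · have h1 : 0 < (layer L j k i).length := List.length_pos_of_mem hmem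
      have h2 := (h.length_layer i).resolve_left (List.ne_nil_of_mem hmem)
      have h3 : (crossPairs L j k).length ≤ L.length * L.length :=
        (List.length_filter_le _ _).trans (length_vertexPairs L).le
      omega
    · cases hl : layer L j k i with
      | nil => rw [hl] at hmem; simp at hmem
      | cons => rfl
  · rw [layer_succ]
    exact mem_peel.2 ⟨hmem, e', he', hb⟩

theorem IsGapPair.below_trans (h : IsGapPair L j k G A B) {e f g : ℕ × ℕ}
    (hf : f ∈ crossPairs L j k) (hef : below L j e f = true) (hfg : below L j f g = true) :
    below L j e g = true := by
  obtain ⟨a, b, rfl⟩ := h.exists_of_mem_crossPairs hf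
  have := (h.mem_crossPairs a b).1 hf
  rw [below_iff] at *
  simp only at *
  omega

/-- Below a pair of a layer there is a long chain of pairs. -/
theorem IsGapPair.exists_chain (h : IsGapPair L j k G A B) (i : ℕ) {e : ℕ × ℕ}
    (he : e ∈ layer L j k i) : ∃ l : List (ℕ × ℕ), l.length = i + 1 ∧
      (∀ x ∈ l, x ∈ crossPairs L j k) ∧ l.Pairwise (fun x y => below L j y x = true) ∧
      ∀ x ∈ l, x = e ∨ below L j x e = true := by
  induction i generalizing e with
  | zero => exact ⟨[e], rfl, by simpa using layer_subset_crossPairs he, by simp, by simp⟩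
  | succ i ih =>
    rw [layer_succ, mem_peel] at he
    obtain ⟨he, e', he', hb⟩ := he
    obtain ⟨l, hl, hl1, hl2, hl3⟩ := ih he'
    have hbe : ∀ x ∈ l, below L j x e = true := by
      intro x hx
      rcases hl3 x hx with rfl | h'
      · exact hb
      · exact h.below_trans (layer_subset_crossPairs he') h' hb
    refine ⟨e :: l, by simp [hl], ?_, List.pairwise_cons.2 ⟨hbe, hl2⟩, ?_⟩
    · exact List.forall_mem_cons.2 ⟨layer_subset_crossPairs he, hl1⟩
    · exact List.forall_mem_cons.2 ⟨.inl rfl, fun x hx => .inr (hbe x hx)⟩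

/-- The pair `e` is separated by the interval model `I`. -/
def Separates {n : ℕ} {S : Set (Fin n)} (I : IntervalModel S) (e : ℕ × ℕ) : Prop :=
  ∃ a b : S, e = ((a : ℕ), (b : ℕ)) ∧ I.right a < I.left b ∨
    e = ((a : ℕ), (b : ℕ)) ∧ I.right b < I.left a

/-- If `(a, b)` is below `(c, d)`, then `a` is near `c` and `d`, and `b` is near `c` and `d`. In an
interval model, disjoint intervals for `a` and `b` then force those of `c` and `d` to share the
stretch between them. -/
theorem IsGapPair.not_separates (h : IsGapPair L j k G A B)
    {I : IntervalModel ↥(A ∪ B)} (hI : ∀ u v, (G.induce (A ∪ B)).Adj u v → I.graph.Adj u v)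
    {e f : ℕ × ℕ} (he : e ∈ crossPairs L j k) (hf : f ∈ crossPairs L j k)
    (hef : below L j e f = true) (hIe : Separates I e) : ¬ Separates I f := by
  have hI' : ∀ u v : ↥(A ∪ B), u = v ∨ G.Adj u v → I.left u ≤ I.right v ∧ I.left v ≤ I.right u := by
    rintro u v (rfl | huv)
    · exact ⟨(I.left_lt_right u).le, (I.left_lt_right u).le⟩
    · exact ((IntervalModel.adj_iff I).1 (hI u v huv)).2
  intro hIf
  obtain ⟨a, b, hab⟩ := hIe
  obtain ⟨c, d, hcd⟩ := hIf
  obtain rfl : e = ((a : ℕ), (b : ℕ)) := by rcases hab with h | h <;> exact h.1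
  obtain rfl : f = ((c : ℕ), (d : ℕ)) := by rcases hcd with h | h <;> exact h.1
  simp only [true_and] at hab hcd
  obtain ⟨ha, hb, -⟩ := (h.mem_crossPairs a b).1 he
  obtain ⟨hc, hd, -⟩ := (h.mem_crossPairs c d).1 hf
  rw [below_iff] at hef
  have h1 := hI' a c (or_iff_not_imp_left.2 fun hne =>
    h.clique_left ha hc (fun h' => hne (Subtype.ext h')))
  have h2 := hI' b d (or_iff_not_imp_left.2 fun hne =>
    h.clique_right hb hd (fun h' => hne (Subtype.ext h')))
  have h3 := hI' a d (.inr ((h.adj_iff ha hd).2 (.inl hef.2)))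
  have h4 := hI' c b (.inr ((h.adj_iff hc hb).2 (.inr hef.1)))
  rcases hab with hab | hab <;> rcases hcd with hcd | hcd <;> linarith

/-- A nonempty layer of index `i` yields a chain of `i + 1` pairs. Each needs its own model, so `i`
is less than the number of models. -/
theorem IsGapPair.length_layers_le (h : IsGapPair L j k G A B)
    {Ls : List (IntervalModel ↥(A ∪ B))} (hLs : IsBoxRep Ls (G.induce (A ∪ B))) :
    (layers L j k).length ≤ Ls.length := by
  have hsep : ∀ e, ∃ i : ℕ, e ∈ crossPairs L j k → ∃ hi : i < Ls.length, Separates Ls[i] e := by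
    intro e
    by_cases he : e ∈ crossPairs L j k
    · obtain ⟨a, b, rfl⟩ := h.exists_of_mem_crossPairs he
      obtain ⟨ha, hb, hlt⟩ := (h.mem_crossPairs a b).1 he
      have hne : a ≠ b := fun h' => Set.disjoint_left.1 h.disjoint ha (h' ▸ hb)
      have hnadj : ¬ (G.induce (A ∪ B)).Adj ⟨a, .inl ha⟩ ⟨b, .inr hb⟩ := by
        intro h'
        have := (h.adj_iff ha hb).1 h'
        omega
      rw [hLs _ _ fun h' => hne (congrArg Subtype.val h')] at hnadj
      push Not at hnadj
      obtain ⟨I, hI, hI'⟩ := hnadj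
      obtain ⟨i, hi, rfl⟩ := List.mem_iff_getElem.1 hI
      refine ⟨i, fun _ => ⟨hi, ⟨a, .inl ha⟩, ⟨b, .inr hb⟩, ?_⟩⟩
      rw [IntervalModel.adj_iff] at hI'
      have hne' : (⟨a, .inl ha⟩ : ↥(A ∪ B)) ≠ ⟨b, .inr hb⟩ :=
        fun h' => hne (congrArg Subtype.val h')
      simp only [true_and]
      grind
    · exact ⟨0, fun h' => absurd h' he⟩
  choose idx hidx using hsep
  have hbound : ∀ i, layer L j k i ≠ [] → i < Ls.length := by
    intro i hi
    obtain ⟨e, he⟩ := List.exists_mem_of_ne_nil _ hi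
    obtain ⟨l, hl, hl1, hl2, -⟩ := h.exists_chain i he
    have hnd : (l.map idx).Nodup := by
      rw [List.Nodup, List.pairwise_map]
      refine List.Pairwise.imp_of_mem ?_ hl2
      intro x y hx hy hxy heq
      obtain ⟨hi, hs⟩ := hidx x (hl1 x hx)
      obtain ⟨hi', hs'⟩ := hidx y (hl1 y hy)
      simp only [heq] at hs
      exact h.not_separates (fun u v huv => (hLs u v huv.ne).1 huv _ (List.getElem_mem hi'))
        (hl1 y hy) (hl1 x hx) hxy hs' hs
    have hsub : l.map idx ⊆ List.range Ls.length := by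
      intro i hi
      obtain ⟨x, hx, rfl⟩ := List.mem_map.1 hi
      exact List.mem_range.2 (hidx x (hl1 x hx)).1
    have := (hnd.subperm hsub).length_le
    rw [List.length_map, List.length_range, hl] at this
    omega
  rw [layers, List.filter_map, List.length_map]
  have hnd : ((List.range (L.length * L.length)).filter
      ((fun R : List (ℕ × ℕ) => !R.isEmpty) ∘ fun i => layer L j k i)).Nodup :=
    List.nodup_range.filter _
  have hsub : (List.range (L.length * L.length)).filter
      ((fun R : List (ℕ × ℕ) => !R.isEmpty) ∘ fun i => layer L j k i) ⊆ List.range Ls.length := by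
    intro i hi
    have := (List.mem_filter.1 hi).2
    refine List.mem_range.2 (hbound i fun h' => ?_)
    simp [h'] at this
  simpa using (hnd.subperm hsub).length_le

/-- The interval models of the layers. -/
noncomputable def IsGapPair.layerModels (h : IsGapPair L j k G A B) :
    List (IntervalModel (Fin n)) :=
  (layers L j k).map fun R => (h.isIntervalOrder_layerRel R).model

/-- Every cross pair is minimal in some layer. Its lower corner then lies in the down-set of that
layer, and its own upper corner does not, so the layer separates it. No layer separates adjacent
vertices, as `layerRel` holds for cross pairs only. -/
theorem IsGapPair.isOptimalBoxRep (h : IsGapPair L j k G A B) :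
    IsOptimalBoxRep (h.layerModels.map fun I => I.restrict (A ∪ B)) (G.induce (A ∪ B)) := by
  refine ⟨fun u v huv => ?_, fun L' hL' => by
    simpa [layerModels] using h.length_layers_le hL'⟩
  have huv' : (u : Fin n) ≠ v := fun h' => huv (Subtype.ext h')
  have hR : (∀ I ∈ h.layerModels.map fun I => I.restrict (A ∪ B), I.graph.Adj u v) ↔
      ∀ R ∈ layers L j k, ¬ layerRel L j k R u v ∧ ¬ layerRel L j k R v u := by
    simp only [layerModels, List.mem_map, forall_exists_index, and_imp, forall_apply_eq_imp_iff₂,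
      IntervalModel.restrict_adj_iff, IsIntervalOrder.model_adj_iff]
    simp [huv']
  rw [hR]
  have key : ∀ a ∈ A, ∀ b ∈ B, ¬ G.Adj a b → ∃ R ∈ layers L j k, layerRel L j k R a b := by
    intro a ha b hb hab
    rw [h.adj_iff ha hb] at hab
    push Not at hab
    have hmem := (h.mem_crossPairs a b).2 ⟨ha, hb, hab.2, hab.1⟩
    obtain ⟨R, hR, he, hmin⟩ := h.exists_layer hmem
    refine ⟨R, hR, (h.layerRel_iff R a b).2 ⟨hmem, fun e he' hlt => hmin e he' (below_iff.2 hlt),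
      _, he, le_rfl, le_rfl⟩⟩
  have key' : ∀ a b : Fin n, ∀ R, layerRel L j k R a b → ¬ G.Adj a b := by
    intro a b R hab hadj
    rw [h.layerRel_iff, h.mem_crossPairs] at hab
    have := (h.adj_iff hab.1.1 hab.1.2.1).1 hadj
    omega
  constructor
  · intro hadj R hR
    exact ⟨fun h' => key' _ _ R h' hadj, fun h' => key' _ _ R h' hadj.symm⟩
  · intro hall
    by_contra hadj
    have hadj' : ¬ G.Adj (u : Fin n) v := hadj
    rcases u.2 with hu | hu <;> rcases v.2 with hv | hv
    · exact hadj' (h.clique_left hu hv huv')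
    · obtain ⟨R, hR, h'⟩ := key _ hu _ hv hadj'
      exact (hall R hR).1 h'
    · obtain ⟨R, hR, h'⟩ := key _ hv _ hu (fun h' => hadj' h'.symm)
      exact (hall R hR).2 h'
    · exact hadj' (h.clique_right hu hv huv')

theorem IsGapPair.forall₂_isExtension (h : IsGapPair L j k G A B) (hne : A.Nonempty) :
    List.Forall₂ IsExtension (h.layerModels.map fun I => I.restrict (A ∪ B)) h.layerModels := by
  rw [List.forall₂_map_left_iff, List.forall₂_same]
  intro I hI
  obtain ⟨R, -, rfl⟩ := List.mem_map.1 hI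
  refine (h.isIntervalOrder_layerRel R).isExtension (hne.mono Set.subset_union_left) ?_
  intro u v huv
  rw [h.layerRel_iff, h.mem_crossPairs] at huv
  exact ⟨.inl huv.1.1, .inr huv.1.2.1⟩

end


/-! ### Positions and gaps of a circular arc model -/

namespace CAModel

variable {n : ℕ} (M : CAModel (Fin n))

/-- The end points of the arcs. -/
def endPoints : Set Circ := {y | ∃ v, y = M.s v ∨ y = M.t v}

theorem endPoints_eq : M.endPoints = M.s '' Set.univ ∪ M.t '' Set.univ := by
  ext y
  simp only [endPoints, Set.image_univ, Set.mem_union, Set.mem_range, Set.mem_ofPred_eq, exists_or,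
    eq_comm]

theorem finite_endPoints : M.endPoints.Finite := by
  rw [endPoints_eq]
  exact (Set.toFinite _).union (Set.toFinite _)

theorem ncard_endPoints_le : M.endPoints.ncard ≤ 2 * n := by
  rw [endPoints_eq]
  refine (Set.ncard_union_le _ _).trans ?_
  have h1 := Set.ncard_image_le (f := M.s) (Set.finite_univ (α := Fin n))
  have h2 := Set.ncard_image_le (f := M.t) (Set.finite_univ (α := Fin n))
  rw [Set.ncard_univ, Nat.card_fin] at h1 h2
  omega

theorem s_mem (v : Fin n) : M.s v ∈ M.endPoints := ⟨v, .inl rfl⟩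

theorem t_mem (v : Fin n) : M.t v ∈ M.endPoints := ⟨v, .inr rfl⟩

/-- Coinciding end points count once and share a rank. The inequality is strict because `x` itself
is counted for `y`. -/
theorem rank_lt_iff {x y : Circ} (hx : x ∈ M.endPoints) :
    M.rank x < M.rank y ↔ coord x < coord y := by
  have hfin : ∀ z, {w | w ∈ M.endPoints ∧ coord w < coord z}.Finite := fun z =>
    M.finite_endPoints.subset fun w hw => hw.1
  constructor
  · intro h
    by_contra hle
    rw [not_lt] at hle
    exact h.not_ge (Set.ncard_le_ncard (fun w hw => ⟨hw.1, hw.2.trans_le hle⟩) (hfin x))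
  · intro h
    refine Set.ncard_lt_ncard ⟨fun w hw => ⟨hw.1, hw.2.trans h⟩, fun hsub => ?_⟩ (hfin y)
    exact (lt_irrefl _ (hsub (show x ∈ {w | w ∈ M.endPoints ∧ coord w < coord y} from ⟨hx, h⟩)).2)

theorem rank_le_iff {x y : Circ} (hy : y ∈ M.endPoints) :
    M.rank x ≤ M.rank y ↔ coord x ≤ coord y := by
  rw [← not_lt, M.rank_lt_iff hy, not_lt]

theorem rank_lt {x : Circ} (hx : x ∈ M.endPoints) : M.rank x < 2 * n := by
  refine lt_of_lt_of_le (Set.ncard_lt_ncard ⟨fun w hw => hw.1, fun hsub => ?_⟩ M.finite_endPoints)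
    M.ncard_endPoints_le
  exact lt_irrefl _ (hsub hx).2

/-- The list of the positions of the end points. -/
noncomputable def codeList : List (ℕ × ℕ) :=
  List.ofFn fun v => (M.rank (M.s v), M.rank (M.t v))

theorem enc_codeList : Enc.enc M.codeList = M.code := by
  change Data.ofList (List.map _ (List.ofFn _)) = _
  rw [List.map_ofFn]
  rfl

@[simp] theorem length_codeList : M.codeList.length = n := List.length_ofFn

theorem getD_codeList (v : Fin n) :
    M.codeList.getD v (0, 0) = (M.rank (M.s v), M.rank (M.t v)) := by
  rw [List.getD_eq_getElem _ _ (by simp)]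
  exact List.getElem_ofFn _

@[simp] theorem startPos_codeList (v : Fin n) : startPos M.codeList v = M.rank (M.s v) := by
  rw [startPos, getD_codeList]

@[simp] theorem endPos_codeList (v : Fin n) : endPos M.codeList v = M.rank (M.t v) := by
  rw [endPos, getD_codeList]

/-- Positions are below `2 * n`, so each unary numeral has size less than `4 * n`. -/
theorem esize_codeList_le : esize M.codeList ≤ n * (8 * n + 4) + 1 := by
  have h : ∀ l : List (ℕ × ℕ), (∀ x ∈ l, esize x + 1 ≤ 8 * n + 4) →
      esize l ≤ l.length * (8 * n + 4) + 1 := by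
    intro l
    induction l with
    | nil => simp
    | cons x l ih =>
      intro hl
      rw [List.forall_mem_cons] at hl
      have := ih hl.2
      rw [esize_list_cons, List.length_cons, Nat.succ_mul]
      omega
  have := h M.codeList fun x hx => by
    obtain ⟨v, rfl⟩ := (List.mem_ofFn' _ _).1 hx
    have h1 := M.rank_lt (M.s_mem v)
    have h2 := M.rank_lt (M.t_mem v)
    rw [esize_pair, esize_nat, esize_nat]
    omega
  simpa using this

theorem pos_zero (x : Circ) : pos 0 x = coord x := by rw [pos, sub_zero]

theorem near_codeList (u v : Fin n) : near M.codeList u v ↔ u = v ∨ M.graph.Adj u v := by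
  rw [M.adj_iff_pos 0, near, twoOf_iff]
  simp only [startPos_codeList, endPos_codeList, M.rank_le_iff (M.t_mem _),
    M.rank_lt_iff (M.t_mem _), pos_zero]
  by_cases h : u = v
  · subst h
    simp only [ne_eq, not_true, false_and, or_false]
    grind
  · simp [h]

/-- The point `p` lies in the gap following the end points of position `j`. -/
def IsGap (j : ℕ) (p : Circ) : Prop :=
  ∀ y ∈ M.endPoints, (M.rank y ≤ j → coord y < coord p) ∧ (j < M.rank y → coord p < coord y)

theorem exists_isGap {e : Circ} (he : e ∈ M.endPoints) : ∃ p, M.IsGap (M.rank e) p := by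
  -- The candidates for the next end point after `e`; the `1` stands for the end of the coordinate
  -- range when `e` is the last.
  let T : Set ℝ := insert 1 (coord '' {y | y ∈ M.endPoints ∧ coord e < coord y})
  have hT : T.Finite := ((M.finite_endPoints.subset fun y hy => hy.1).image _).insert _
  obtain ⟨b, hb, hmin⟩ := T.exists_min_image id hT ⟨1, Set.mem_insert _ _⟩
  have heb : coord e < b := by
    rcases hb with rfl | ⟨y, hy, rfl⟩
    · exact coord_lt_one e
    · exact hy.2
  obtain ⟨m, hm, hm'⟩ := exists_between heb
  have hm1 : m < 1 := hm'.trans_le (hmin 1 (Set.mem_insert _ _))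
  refine ⟨(m : Circ), fun y hy => ?_⟩
  rw [coord_coe ((coord_nonneg e).trans hm.le) hm1, M.rank_le_iff he, M.rank_lt_iff he]
  exact ⟨fun h => h.trans_lt hm, fun h =>
    hm'.trans_le (hmin _ (Set.mem_insert_of_mem _ ⟨y, ⟨hy, h⟩, rfl⟩))⟩

variable {M} {j k : ℕ} {p q : Circ}

theorem IsGap.ne (h : M.IsGap j p) {y : Circ} (hy : y ∈ M.endPoints) : y ≠ p := by
  rintro rfl
  rcases le_or_gt (M.rank y) j with h' | h'
  · exact lt_irrefl _ ((h y hy).1 h')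
  · exact lt_irrefl _ ((h y hy).2 h')

theorem pos_eq (p x : Circ) :
    pos p x = if coord p ≤ coord x then coord x - coord p else coord x - coord p + 1 :=
  coord_sub x p

/-- Adding `2 * n` moves the positions up to `j` behind all the others, which is the order in which
the end points are met clockwise from `p`. -/
theorem IsGap.cutKey_le_iff (h : M.IsGap j p) {x y : Circ} (hx : x ∈ M.endPoints)
    (hy : y ∈ M.endPoints) :
    cutKey M.codeList j (M.rank x) ≤ cutKey M.codeList j (M.rank y) ↔ pos p x ≤ pos p y := by
  have h1 := M.rank_lt hx
  have h2 := M.rank_lt hy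
  have h3 := coord_nonneg x
  have h4 := coord_nonneg y
  have h5 := coord_lt_one x
  have h6 := coord_lt_one y
  have h7 := M.rank_le_iff (x := x) hy
  rw [pos_eq, pos_eq, cutKey, cutKey, length_codeList]
  rcases le_or_gt (M.rank x) j with hxj | hxj <;> rcases le_or_gt (M.rank y) j with hyj | hyj
  · have h8 := (h x hx).1 hxj
    have h9 := (h y hy).1 hyj
    simp [hxj.not_gt, hyj.not_gt, h8.not_ge, h9.not_ge, h7]
  · have h8 := (h x hx).1 hxj
    have h9 := (h y hy).2 hyj
    simp only [hxj.not_gt, hyj, h8.not_ge, h9.le, decide_false, decide_true, cond_false, cond_true,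
      if_true, if_false]
    constructor
    · intro h'; omega
    · intro h'; linarith
  · have h8 := (h x hx).2 hxj
    have h9 := (h y hy).1 hyj
    simp only [hxj, hyj.not_gt, h8.le, h9.not_ge, decide_false, decide_true, cond_false, cond_true,
      if_true, if_false]
    constructor
    · intro h'; linarith
    · intro h'; omega
  · have h8 := (h x hx).2 hxj
    have h9 := (h y hy).2 hyj
    simp [hxj, hyj, h8.le, h9.le, h7]

theorem IsGap.startPt_eq (h : M.IsGap j p) (v : Fin n) : M.startPt p v = pos p (M.s v) :=
  if_neg (h.ne (M.s_mem v))

theorem IsGap.start_le_end_iff (h : M.IsGap j p) (u v : Fin n) :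
    startKey M.codeList j u ≤ endKey M.codeList j v ↔ M.startPt p u ≤ M.endPt p v := by
  rw [startKey, endKey, startPos_codeList, endPos_codeList,
    h.cutKey_le_iff (M.s_mem u) (M.t_mem v), h.startPt_eq, endPt]

theorem IsGap.end_lt_start_iff (h : M.IsGap j p) (u v : Fin n) :
    endKey M.codeList j u < startKey M.codeList j v ↔ M.endPt p u < M.startPt p v := by
  rw [← not_le, h.start_le_end_iff, not_le]

theorem IsGap.end_le_end_iff (h : M.IsGap j p) (u v : Fin n) :
    endKey M.codeList j u ≤ endKey M.codeList j v ↔ M.endPt p u ≤ M.endPt p v := by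
  rw [endKey, endKey, endPos_codeList, endPos_codeList,
    h.cutKey_le_iff (M.t_mem u) (M.t_mem v), endPt, endPt]

theorem IsGap.isCut (h : M.IsGap j p) : IsCut M.graph (M.through p)
    (fun v : Fin n => startKey M.codeList j v) (fun v : Fin n => endKey M.codeList j v) where
  ne v hv := by
    have h1 := (h.start_le_end_iff v v).1 hv.le
    have h2 := (M.isCut p).ne v
    have h3 := (h.end_lt_start_iff v v).2 (h1.lt_of_ne h2 |> fun h' => ?_)
    · omega
    · exfalso
      rw [startKey, endKey, startPos_codeList, endPos_codeList] at hv
      have := (h.cutKey_le_iff (M.t_mem v) (M.s_mem v)).1 hv.ge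
      rw [h.startPt_eq, endPt] at h'
      exact this.not_gt h'
  mem_iff v := by rw [h.end_lt_start_iff]; exact M.mem_through_iff p
  adj_iff u v := by
    rw [(M.isCut p).adj_iff]
    simp only [h.end_lt_start_iff, h.start_le_end_iff]

theorem IsGap.goodGap_iff (h : M.IsGap j p) : goodGap M.codeList j = true ↔ M.NoCoverPairAt p := by
  rw [noCoverPairAt_iff]
  simp only [goodGap, List.all_eq_true, List.mem_range, length_codeList, Bool.or_eq_true,
    Bool.not_eq_true', decide_eq_true_eq]
  constructor
  · intro h' u hu v hv
    rcases h' u u.2 v v.2 with (h1 | h1) | h1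
    · rw [← onGap_iff h.isCut, h1] at hu; simp at hu
    · rw [← onGap_iff h.isCut, h1] at hv; simp at hv
    · exact (h.end_lt_start_iff u v).1 h1
  · intro h' u hu v hv
    have h1 := h' ⟨u, hu⟩
    simp only [← onGap_iff h.isCut] at h1
    have h2 := fun h3 => h1 h3 ⟨v, hv⟩
    rw [← h.end_lt_start_iff] at h2
    simp only at h2
    grind

/-! ### Finding the two gaps -/

theorem headD_filter {l : List ℕ} {f : ℕ → Bool} (h : ∃ x ∈ l, f x = true) (d : ℕ) :
    (l.filter f).headD d ∈ l ∧ f ((l.filter f).headD d) = true := by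
  obtain ⟨x, hx, hfx⟩ := h
  rw [← List.mem_filter]
  cases hl : l.filter f with
  | nil => exact absurd (List.mem_filter.2 ⟨hx, hfx⟩) (by simp [hl])
  | cons y l' => simp

theorem mem_positions {j : ℕ} : j ∈ positions M.codeList ↔ ∃ e ∈ M.endPoints, j = M.rank e := by
  simp only [positions, codeList, List.map_ofFn, List.mem_append, List.mem_ofFn', Set.mem_range,
    Function.comp_apply, endPoints, Set.mem_ofPred_eq]
  constructor
  · rintro (⟨v, rfl⟩ | ⟨v, rfl⟩)
    · exact ⟨_, ⟨v, .inl rfl⟩, rfl⟩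
    · exact ⟨_, ⟨v, .inr rfl⟩, rfl⟩
  · rintro ⟨e, ⟨v, rfl | rfl⟩, rfl⟩
    · exact .inl ⟨v, rfl⟩
    · exact .inr ⟨v, rfl⟩

/-- Every point has a gap at which there are no further arcs. -/
theorem exists_through_subset (hne : M.endPoints.Nonempty) (p' : Circ) :
    ∃ e ∈ M.endPoints, ∀ p, M.IsGap (M.rank e) p → M.through p ⊆ M.through p' := by
  have key : ∀ e ∈ M.endPoints, (∀ y ∈ M.endPoints, coord y ≤ coord p' ↔ coord y ≤ coord e) ∨
      (∀ y ∈ M.endPoints, coord p' < coord y ∧ coord y ≤ coord e) →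
      ∀ p, M.IsGap (M.rank e) p → M.through p ⊆ M.through p' := by
    intro e he hcase p hp v hv
    change p ∈ M.arc v at hv
    change p' ∈ M.arc v
    rw [M.mem_arc_iff 0] at hv ⊢
    simp only [pos_zero] at hv ⊢
    have h1 := hp _ (M.s_mem v)
    have h2 := hp _ (M.t_mem v)
    rw [M.rank_le_iff he, M.rank_lt_iff he] at h1 h2
    rcases hcase with hc | hc
    · have h3 := hc _ (M.s_mem v)
      have h4 := hc _ (M.t_mem v)
      grind
    · have h3 := hc _ (M.s_mem v)
      have h4 := hc _ (M.t_mem v)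
      grind
  -- The gap after the last end point at or before `p'` works. If there is none, `p'` precedes all
  -- end points and the gap after the last of them reaches it across coordinate `0`.
  by_cases h : ∃ y ∈ M.endPoints, coord y ≤ coord p'
  · obtain ⟨e, he, hmax⟩ := Set.exists_max_image {y | y ∈ M.endPoints ∧ coord y ≤ coord p'} coord
      (M.finite_endPoints.subset fun y hy => hy.1) h
    exact ⟨e, he.1, key e he.1 (.inl fun y hy => ⟨fun h' => hmax y ⟨hy, h'⟩, fun h' =>
      h'.trans he.2⟩)⟩
  · push Not at h
    obtain ⟨e, he, hmax⟩ := Set.exists_max_image M.endPoints coord M.finite_endPoints hne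
    exact ⟨e, he, key e he (.inr fun y hy => ⟨h y hy, hmax y hy⟩)⟩

theorem exists_firstGap (hne : M.endPoints.Nonempty) (h : ∃ p', M.NoCoverPairAt p') :
    ∃ p, M.IsGap (firstGap M.codeList) p ∧ M.NoCoverPairAt p := by
  obtain ⟨p', hp'⟩ := h
  obtain ⟨e, he, hsub⟩ := exists_through_subset hne p'
  obtain ⟨p, hp⟩ := M.exists_isGap he
  have hgood : goodGap M.codeList (M.rank e) = true :=
    hp.goodGap_iff.2 fun u hu v hv => hp' u (hsub p hp hu) v (hsub p hp hv)
  obtain ⟨h1, h2⟩ := headD_filter (f := fun j => goodGap M.codeList j)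
    ⟨_, mem_positions.2 ⟨e, he, rfl⟩, hgood⟩ 0
  obtain ⟨e', he', hj⟩ := mem_positions.1 h1
  obtain ⟨p, hp⟩ := M.exists_isGap he'
  rw [← hj] at hp
  exact ⟨p, hp, hp.goodGap_iff.1 h2⟩

/-- A point right after the farthest end lies beyond every end, and before every start because
admissibility leaves room there. -/
theorem exists_secondGap (hp : M.IsGap j p) (hcov : M.NoCoverPairAt p)
    (hne : (M.through p).Nonempty) :
    ∃ q, M.IsGap (secondGap M.codeList j) q ∧ M.IsSecondPoint p q := by
  have hfar : ∀ a : Fin n, isFarthest M.codeList j a = true ↔ a ∈ M.through p ∧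
      ∀ c ∈ M.through p, M.endPt p c ≤ M.endPt p a := by
    intro a
    simp only [isFarthest, Bool.and_eq_true, onGap_iff hp.isCut, List.all_eq_true, List.mem_range,
      length_codeList, Bool.or_eq_true, Bool.not_eq_true', decide_eq_true_eq]
    refine and_congr_right fun _ => ⟨fun h c hc => ?_, fun h c hc => ?_⟩
    · rw [← hp.end_le_end_iff]
      refine (h c c.2).resolve_left fun h' => ?_
      rw [← onGap_iff hp.isCut, h'] at hc
      simp at hc
    · have := h ⟨c, hc⟩
      rw [← onGap_iff hp.isCut, ← hp.end_le_end_iff] at this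
      simp only at this
      grind
  obtain ⟨a, ha, hmax⟩ := Set.exists_max_image (M.through p) (M.endPt p) (Set.toFinite _) hne
  obtain ⟨h1, h2⟩ := headD_filter (f := fun a => isFarthest M.codeList j a)
    (l := List.range M.codeList.length) ⟨a, by simp, (hfar a).2 ⟨ha, hmax⟩⟩ 0
  obtain ⟨b, hb⟩ : ∃ b : Fin n, (b : ℕ) = ((List.range M.codeList.length).filter
      fun a => isFarthest M.codeList j a).headD 0 :=
    ⟨⟨_, (List.mem_range.1 h1).trans_eq M.length_codeList⟩, rfl⟩
  rw [← hb] at h2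
  obtain ⟨hbp, hbmax⟩ := (hfar b).1 h2
  have hk : secondGap M.codeList j = M.rank (M.t b) := by
    rw [secondGap, ← hb, endPos_codeList]
  obtain ⟨q, hq⟩ := M.exists_isGap (M.t_mem b)
  refine ⟨q, hk ▸ hq, (M.isSecondPoint_iff hcov).2 ⟨hne, fun v hv => ?_⟩⟩
  have h3 := (M.noCoverPairAt_iff.1 hcov) b hbp v hv
  have h4 := hbmax v hv
  suffices h : M.endPt p b < pos p q ∧ pos p q < M.startPt p v from ⟨h4.trans_lt h.1, h.2⟩
  rw [hp.startPt_eq, endPt, pos_eq, pos_eq] at h3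
  rw [hp.startPt_eq, endPt, pos_eq, pos_eq, pos_eq]
  have h5 := (hq _ (M.t_mem b)).1 le_rfl
  have h6 := (hq _ (M.s_mem v)).2
  rw [M.rank_lt_iff (M.t_mem b)] at h6
  have h7 := coord_nonneg (M.s v)
  have h8 := coord_lt_one (M.s v)
  have h9 := coord_nonneg (M.t b)
  have h10 := coord_lt_one q
  grind

theorem hasCode_enc {out : List (IntervalModel (Fin n))} {ms : List (List (ℕ × ℕ))}
    (h : List.Forall₂ (fun I m => I.HasCode (Enc.enc m)) out ms) : HasCode out (Enc.enc ms) :=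
  ⟨ms.map Enc.enc, List.forall₂_map_right_iff.2 h, rfl⟩

/-- The models computed by the algorithm. -/
theorem exists_output (h : ∃ p', M.NoCoverPairAt p') :
    ∃ (p : Circ) (out : List (IntervalModel (Fin n))), M.NoCoverPairAt p ∧
      M.IsAlgorithmOutput p out ∧ HasCode out (Enc.enc (algorithm M.codeList)) := by
  have hn := M.length_codeList
  -- The test decides whether the graph is an interval graph. If so, the given admissible point
  -- serves, since the output does not depend on it.
  cases hc : conflict M.codeList
  · have ho := isIntervalOrder_lexRel hn hc fun v => (M.near_codeList v v).2 (.inl rfl)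
    have hg := graph_lexRel hn M.near_codeList hc ho
    obtain ⟨p', hp'⟩ := h
    refine ⟨p', [ho.model], hp', .inl ⟨⟨_, hg⟩, _, hg, rfl⟩, ?_⟩
    rw [algorithm, hc, cond_false, hn]
    exact hasCode_enc (.cons ho.hasCode_model .nil)
  · have hni := not_isIntervalGraph_of_conflict hn M.near_codeList hc
    have hne : M.endPoints.Nonempty := by
      obtain ⟨u, -⟩ := (conflict_iff hn).1 hc
      exact ⟨_, M.s_mem u⟩
    obtain ⟨p, hp, hcov⟩ := exists_firstGap hne h
    obtain ⟨q, hq, hpq⟩ := exists_secondGap hp hcov (M.through_nonempty hni p)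
    have hgp : IsGapPair M.codeList (firstGap M.codeList)
        (secondGap M.codeList (firstGap M.codeList)) M.graph (M.through p) (M.through q) :=
      ⟨hn, M.near_codeList, hp.isCut, hq.isCut, M.disjoint_through hcov hpq⟩
    have hA := isIntervalOrder_cutRel hp.isCut
    have hB := isIntervalOrder_cutRel hq.isCut
    refine ⟨p, hgp.layerModels ++ [hA.model, hB.model], hcov, .inr ⟨hni, q, hpq, _, _, _, _, _, _,
      hgp.isOptimalBoxRep, hgp.forall₂_isExtension (M.through_nonempty hni p),
      cutRel_model_graph hp.isCut, hA.isExtension (M.compl_through_nonempty hni p) fun u v huv => ?_,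
      cutRel_model_graph hq.isCut, hB.isExtension (M.compl_through_nonempty hni q) fun u v huv => ?_,
      rfl⟩, ?_⟩
    · rw [cutRel_iff hp.isCut] at huv
      exact ⟨huv.1, huv.2.1⟩
    · rw [cutRel_iff hq.isCut] at huv
      exact ⟨huv.1, huv.2.1⟩
    · rw [algorithm, hc, cond_true, mainOutput, hn]
      refine hasCode_enc (List.rel_append ?_ (.cons hA.hasCode_model (.cons hB.hasCode_model .nil)))
      rw [IsGapPair.layerModels, List.forall₂_map_left_iff, List.forall₂_map_right_iff,
        List.forall₂_same]
      exact fun R _ => (hgp.isIntervalOrder_layerRel R).hasCode_model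

theorem exists_prog : ∃ (P : Prog) (T : Polynomial ℕ),
    ∀ (n : ℕ) (M : CAModel (Fin n)), (∃ p', M.NoCoverPairAt p') →
      ∃ (p : Circ) (out : List (IntervalModel (Fin n))) (d : Data) (k : ℕ),
        M.NoCoverPairAt p ∧ M.IsAlgorithmOutput p out ∧ HasCode out d ∧
        Runs P M.code d k ∧ k ≤ T.eval n := by
  obtain ⟨P, T, hP⟩ := PT.algorithm
  -- `PT` bounds the time in the size of the encoded input, and this size is quadratic in `n`.
  refine ⟨P, T.comp (Polynomial.X * (8 * Polynomial.X + 4) + 1), fun n M hM => ?_⟩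
  obtain ⟨p, out, hp, hout, hcode⟩ := exists_output hM
  obtain ⟨k, hk, hk'⟩ := hP M.codeList
  rw [M.enc_codeList] at hk
  refine ⟨p, out, _, k, hp, hout, hcode, hk, ?_⟩
  have h1 := eval_mono T M.esize_codeList_le
  rw [Polynomial.eval_comp]
  have h2 : (Polynomial.X * (8 * Polynomial.X + 4) + 1 : Polynomial ℕ).eval n =
      n * (8 * n + 4) + 1 := by simp
  rw [h2]
  omega

end CAModel

end BoxApprox

theorem mainTheorem2 :
    -- correctness, for all choices that the algorithm can make
    (∀ (n : ℕ) (M : BoxApprox.CAModel (Fin n)) (p : BoxApprox.Circ), M.NoCoverPairAt p →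
      (∃ out, M.IsAlgorithmOutput p out) ∧
      (∀ out, M.IsAlgorithmOutput p out →
        BoxApprox.IsBoxRep out M.graph ∧ out.length ≤ BoxApprox.boxicity M.graph + 2) ∧
      (¬ BoxApprox.IsIntervalGraph M.graph →
        (∃ q, M.IsSecondPoint p q) ∧
        ∀ q, M.IsSecondPoint p q → ∃ out, M.IsMainOutput p q out) ∧
      (∀ q, M.IsSecondPoint p q →
        M.graph.IsClique (M.through p) ∧ M.graph.IsClique (M.through q) ∧
        Disjoint (M.through p) (M.through q) ∧
        (M.subgraphAt p q)ᶜ.IsBipartite ∧ BoxApprox.IsCAGraph (M.subgraphAt p q) ∧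
        ∀ out, M.IsMainOutput p q out →
          BoxApprox.IsBoxRep out M.graph ∧
          out.length = BoxApprox.boxicity (M.subgraphAt p q) + 2 ∧
          BoxApprox.boxicity (M.subgraphAt p q) + 2 ≤ BoxApprox.boxicity M.graph + 2)) ∧
    -- every point of a normal model qualifies
    (∀ (n : ℕ) (M : BoxApprox.CAModel (Fin n)), M.IsNormal → ∀ p, M.NoCoverPairAt p) ∧
    -- one program carries the algorithm out in polynomial time
    (∃ (P : BoxApprox.Prog) (T : Polynomial ℕ),
      ∀ (n : ℕ) (M : BoxApprox.CAModel (Fin n)), (∃ p', M.NoCoverPairAt p') →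
        ∃ (p : BoxApprox.Circ) (out : List (BoxApprox.IntervalModel (Fin n)))
          (d : BoxApprox.Data) (k : ℕ),
          M.NoCoverPairAt p ∧ M.IsAlgorithmOutput p out ∧ BoxApprox.HasCode out d ∧
          BoxApprox.Runs P M.code d k ∧ k ≤ T.eval n) := by
  refine ⟨fun n M p hp => ⟨M.exists_isAlgorithmOutput hp, fun out hout => hout.isBoxRep hp,
    fun h => ⟨M.exists_isSecondPoint hp (M.through_nonempty h p), fun q _ =>
      M.exists_isMainOutput h⟩, fun q hq => ⟨M.isClique_through p, M.isClique_through q,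
      M.disjoint_through hp hq, M.isBipartite_compl_subgraphAt p q, M.isCAGraph_subgraphAt p q,
      fun out hout => ⟨hout.isBoxRep (M.disjoint_through hp hq), hout.length_eq,
        Nat.add_le_add_right (BoxApprox.boxicity_induce_le _ _) 2⟩⟩⟩,
    fun n M hM p u _ v _ => hM u v, BoxApprox.CAModel.exists_prog⟩
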